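/- Let $S$ be a non-empty subset of $\mathbb{N}^* = \{1,2,3,\dots\}$ with $S \neq \{1\}$. Let $a_n$ be the number of crossing-free partitions of $n$ points on a circle, labelled $1,\dots,n$ counterclockwise, all of whose blocks have cardinality in $S$. Here a partition is crossing-free if no chord joining two points of one block crosses a chord joining two points of a different block, and $a_0 = 1$. Let $P(x) = \sum_{n\ge 0} a_n x^n$ be the generating function and let $\gcd(S)$ be the greatest common divisor of all elements of $S$. There is a unique real number $\tau_S > 0$ such that the series $\sum_{s\in S} (s-1)\tau_S^s$ converges with sum $1$; moreover, the series below converge, and the constants \[ \rho_S = \frac{\tau_S}{\sum_{s\in S} s\,\tau_S^s},\qquad \alpha_S = 1+\sum_{s\in S}\tau_S^s,\qquad \beta_S = \sqrt{\frac{2\big(\sum_{s\in S} s\,\tau_S^s\big)^3}{\sum_{s\in S} s(s-1)\,\tau_S^s}} \] are well defined and $\rho_S, \beta_S$ are positive. For $0<\varphi<\pi/2$ and $R>1$, let $\Delta_0(\varphi,R) = \{z\in\mathbb{C} : z\ne 1,\ |z|<R,\ |\mathrm{Arg}(z-1)|>\varphi\}$ and let \[ \Delta = \bigcap_{\xi^{\gcd(S)}=1}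 \rho_S\,\xi\cdot\Delta_0(\varphi,R), \] which is a domain dented at $\rho_S$ (and at its rotations by the $\gcd(S)$-th roots of unity). Then: 1. For some $0<\varphi<\pi/2$ and $R>1$, the series $P(x)$ converges for $|x|<\rho_S$ and extends to an analytic function on $\Delta$, again denoted by $P$, which satisfies \[ P(x) = \alpha_S - \beta_S\sqrt{1-\frac{x}{\rho_S}} + O\Big(1-\frac{x}{\rho_S}\Big)\qquad\text{as } x\to\rho_S,\ x\in\Delta, \] with the principal branch of the square root. 2. As $n\to\infty$ along the multiples of $\gcd(S)$, \[ a_n = \frac{\gcd(S)\,\beta_S}{2\sqrt{\pi}}\; n^{-3/2}\,\rho_S^{-n}\,(1+o(1)). \] 3. $a_n = 0$ whenever $n$ is not a multiple of $\gcd(S)$. -/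

import Mathlib

open Filter Topology Asymptotics

noncomputable section

namespace CrossingFree

/-- A partition of `n` points on a circle, labelled counterclockwise starting from the root, is
crossing-free if no chord joining two points of a block crosses a chord joining two points of a
different block. -/
def IsCrossingFree {n : ℕ} (P : Finpartition (Finset.univ : Finset (Fin n))) : Prop :=
  ∀ U ∈ P.parts, ∀ V ∈ P.parts, U ≠ V →
    ∀ u₁ ∈ U, ∀ u₂ ∈ U, ∀ v₁ ∈ V, ∀ v₂ ∈ V, ¬ (u₁ < v₁ ∧ v₁ < u₂ ∧ u₂ < v₂)

/-- The number of crossing-free partitions of `n` points all of whose block sizes belong to `S`. -/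
def count (S : Set ℕ) (n : ℕ) : ℕ :=
  Nat.card {P : Finpartition (Finset.univ : Finset (Fin n)) //
    IsCrossingFree P ∧ ∀ B ∈ P.parts, B.card ∈ S}

/-- The generating function, by number of points, of the crossing-free partitions with block
sizes in `S`. -/
def genFun (S : Set ℕ) : PowerSeries ℕ := PowerSeries.mk (count S)

/-- The equation `∑_{s ∈ S} (s - 1) t ^ s = 1` (the series being convergent), with `t > 0`. -/
def IsTau (S : Set ℕ) (t : ℝ) : Prop :=
  0 < t ∧ HasSum (fun s : S => (((s : ℕ) : ℝ) - 1) * t ^ (s : ℕ)) 1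

/-- The positive solution of `∑_{s ∈ S} (s - 1) t ^ s = 1`. -/
def tau (S : Set ℕ) : ℝ := Classical.epsilon (IsTau S)

/-- `ρ_S = τ_S / ∑_{s ∈ S} s τ_S ^ s`. -/
def rho (S : Set ℕ) : ℝ := tau S / ∑' s : S, ((s : ℕ) : ℝ) * tau S ^ (s : ℕ)

/-- `α_S = 1 + ∑_{s ∈ S} τ_S ^ s`. -/
def alpha (S : Set ℕ) : ℝ := 1 + ∑' s : S, tau S ^ (s : ℕ)

/-- `β_S = √(2 (∑_{s ∈ S} s τ_S ^ s) ^ 3 / ∑_{s ∈ S} s (s - 1) τ_S ^ s)`. -/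
def beta (S : Set ℕ) : ℝ :=
  Real.sqrt (2 * (∑' s : S, ((s : ℕ) : ℝ) * tau S ^ (s : ℕ)) ^ 3 /
    ∑' s : S, ((s : ℕ) : ℝ) * (((s : ℕ) : ℝ) - 1) * tau S ^ (s : ℕ))

/-- The domain dented at `1` with angle `φ` and radius `R`. -/
def dentedDomain (φ R : ℝ) : Set ℂ :=
  {z | z ≠ 1 ∧ ‖z‖ < R ∧ φ < |Complex.arg (z - 1)|}

/-- The disc dented at all the points `ρ ξ` with `ξ ^ d = 1`, that is, the intersection of the
sets `ρ ξ · dentedDomain φ R`. For `d = 1` it is the domain dented at `ρ`. -/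
def indentedDisc (d : ℕ) (ρ φ R : ℝ) : Set ℂ :=
  {x | ∀ ξ : ℂ, ξ ^ d = 1 → x / ((ρ : ℂ) * ξ) ∈ dentedDomain φ R}

end CrossingFree

end

/-!
Removing the block of the first point cuts the circle into as many arcs as the block has points,
so `P = 1 + ∑_{s ∈ S} (x P) ^ s`. Put `d = gcd(S)`, `Q = P / α_S` and `z = (x / ρ_S) ^ d`. Then
`Q(z) = q(z Q(z) ^ d)` for a power series `q` with nonnegative coefficients of sum `1`, and the
equation defining `τ_S` says that `q ^ d` has derivative `1` at `1`: this is the generating function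
equation of a critical branching process. On the closed unit disc the equation `v = z q(v) ^ d` for
`v = z Q(z) ^ d` can be solved analytically for `v` except at `z = 1`, where it degenerates
quadratically. So `Q` continues analytically across every other point of the unit circle, and near
`z = 1` it is an analytic function of `√(1 - z)`, which gives the expansion. Subtracting multiples
of `√(1 - z)` and `(1 - z) ^ (3 / 2)` leaves a remainder whose second derivative is bounded, so its
coefficients are `O(n ^ (-2))`, and those of `√(1 - z)` give the asymptotics.
-/

namespace CrossingFree

section Partitions

open Finset

variable {α β : Type*} [LinearOrder α] [LinearOrder β] {S : Set ℕ}

/-- `C` is the set of blocks of a crossing-free partition of `A`. Unlike a `Finpartition`, this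
does not carry the ground set in its type, so that partitions of different sets can be joined. -/
structure IsNoncrossing (A : Finset α) (C : Finset (Finset α)) : Prop where
  nonempty : ∀ U ∈ C, U.Nonempty
  mem_iff : ∀ x, x ∈ A ↔ ∃ U ∈ C, x ∈ U
  eq_of_mem : ∀ U ∈ C, ∀ V ∈ C, ∀ x ∈ U, x ∈ V → U = V
  eq_of_crossing : ∀ U ∈ C, ∀ V ∈ C, ∀ a ∈ U, ∀ b ∈ V, ∀ c ∈ U, ∀ d ∈ V,
    a < b → b < c → c < d → U = V

namespace IsNoncrossing

variable {A A₁ A₂ : Finset α} {C C₁ C₂ : Finset (Finset α)}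

theorem subset (h : IsNoncrossing A C) {U : Finset α} (hU : U ∈ C) : U ⊆ A :=
  fun x hx => (h.mem_iff x).2 ⟨U, hU, hx⟩

theorem mono (h : IsNoncrossing A₁ C₁) (hC : C₂ ⊆ C₁) (hA : ∀ x, x ∈ A₂ ↔ ∃ U ∈ C₂, x ∈ U) :
    IsNoncrossing A₂ C₂ where
  nonempty U hU := h.nonempty U (hC hU)
  mem_iff := hA
  eq_of_mem U hU V hV := h.eq_of_mem U (hC hU) V (hC hV)
  eq_of_crossing U hU V hV := h.eq_of_crossing U (hC hU) V (hC hV)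

theorem union (h₁ : IsNoncrossing A₁ C₁) (h₂ : IsNoncrossing A₂ C₂)
    (h : ∀ a ∈ A₁, ∀ b ∈ A₂, a < b) : IsNoncrossing (A₁ ∪ A₂) (C₁ ∪ C₂) where
  nonempty U hU := (mem_union.1 hU).elim (h₁.nonempty U) (h₂.nonempty U)
  mem_iff x := by
    rw [mem_union, h₁.mem_iff, h₂.mem_iff]
    simp only [mem_union, or_and_right, exists_or]
  eq_of_mem U hU V hV x hxU hxV := by
    rcases mem_union.1 hU with hU | hU <;> rcases mem_union.1 hV with hV | hV
    · exact h₁.eq_of_mem U hU V hV x hxU hxV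
    · exact absurd (h x (h₁.subset hU hxU) x (h₂.subset hV hxV)) (lt_irrefl _)
    · exact absurd (h x (h₁.subset hV hxV) x (h₂.subset hU hxU)) (lt_irrefl _)
    · exact h₂.eq_of_mem U hU V hV x hxU hxV
  eq_of_crossing U hU V hV a ha b hb c hc d hd hab hbc hcd := by
    rcases mem_union.1 hU with hU | hU <;> rcases mem_union.1 hV with hV | hV
    · exact h₁.eq_of_crossing U hU V hV a ha b hb c hc d hd hab hbc hcd
    · exact absurd (h c (h₁.subset hU hc) b (h₂.subset hV hb)) hbc.not_gt
    · exact absurd (h b (h₁.subset hV hb) a (h₂.subset hU ha)) hab.not_gt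
    · exact h₂.eq_of_crossing U hU V hV a ha b hb c hc d hd hab hbc hcd

theorem eq_empty (h : IsNoncrossing (∅ : Finset α) C) : C = ∅ := by
  refine eq_empty_of_forall_notMem fun U hU => ?_
  obtain ⟨x, hx⟩ := h.nonempty U hU
  exact notMem_empty x (h.subset hU hx)

theorem filter_subset_union_of_disjoint (h₁ : IsNoncrossing A₁ C₁) (h₂ : IsNoncrossing A₂ C₂)
    {T : Finset α} (hT : A₁ ⊆ T) (hdisj : Disjoint T A₂) : {U ∈ C₁ ∪ C₂ | U ⊆ T} = C₁ := by
  ext U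
  rw [mem_filter, mem_union]
  refine ⟨?_, fun hU => ⟨.inl hU, (h₁.subset hU).trans hT⟩⟩
  rintro ⟨hU | hU, hUT⟩
  · exact hU
  · obtain ⟨x, hx⟩ := h₂.nonempty U hU
    exact (disjoint_left.1 hdisj (hUT hx) (h₂.subset hU hx)).elim

end IsNoncrossing

theorem isNoncrossing_empty : IsNoncrossing (∅ : Finset α) ∅ := by
  constructor <;> simp

theorem isNoncrossing_map {A : Finset α} {C : Finset (Finset α)} (f : α ↪o β) :
    IsNoncrossing (A.map f.toEmbedding) (C.map (mapEmbedding f.toEmbedding).toEmbedding) ↔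
      IsNoncrossing A C := by
  have hmem (y : β) : (∃ U ∈ C, ∃ x ∈ U, f x = y) ↔ ∃ x, (∃ U ∈ C, x ∈ U) ∧ f x = y := by grind
  have heq : (∀ U ∈ C, ∀ V ∈ C, ∀ x ∈ U, ∀ y ∈ V, y = x → U = V) ↔
      ∀ U ∈ C, ∀ V ∈ C, ∀ x ∈ U, x ∈ V → U = V := by grind
  constructor <;> rintro ⟨hne, hcover, hmem_eq, hcross⟩
  · exact ⟨by simpa using hne, fun x => by simpa [hmem] using hcover (f x),
      by simpa [heq] using hmem_eq, by simpa using hcross⟩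
  · exact ⟨by simpa using hne, fun y => by simp [hmem, hcover], by simpa [heq] using hmem_eq,
      by simpa using hcross⟩

open scoped Classical in
/-- The crossing-free partitions of `A` with block sizes in `S`, as sets of blocks. -/
noncomputable def noncrossingPartitions (S : Set ℕ) (A : Finset α) : Finset (Finset (Finset α)) :=
  {C ∈ A.powerset.powerset | IsNoncrossing A C ∧ ∀ U ∈ C, #U ∈ S}

theorem mem_noncrossingPartitions {A : Finset α} {C : Finset (Finset α)} :
    C ∈ noncrossingPartitions S A ↔ IsNoncrossing A C ∧ ∀ U ∈ C, #U ∈ S := by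
  simp only [noncrossingPartitions, mem_filter, mem_powerset, and_iff_right_iff_imp]
  exact fun h U hU => mem_powerset.2 (h.1.subset hU)

theorem noncrossingPartitions_map (A : Finset α) (f : α ↪o β) :
    noncrossingPartitions S (A.map f.toEmbedding) = (noncrossingPartitions S A).map
      (mapEmbedding (mapEmbedding f.toEmbedding).toEmbedding).toEmbedding := by
  ext D
  rw [Finset.mem_map]
  constructor
  · intro hD
    have hDA : D ⊆ A.powerset.map (mapEmbedding f.toEmbedding).toEmbedding := by
      intro V hV
      obtain ⟨U, hU, rfl⟩ := subset_map_iff.1 ((mem_noncrossingPartitions.1 hD).1.subset hV)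
      exact mem_map_of_mem _ (mem_powerset.2 hU)
    obtain ⟨C, -, rfl⟩ := subset_map_iff.1 hDA
    simpa [mem_noncrossingPartitions, isNoncrossing_map] using hD
  · rintro ⟨C, hC, rfl⟩
    simpa [mem_noncrossingPartitions, isNoncrossing_map] using hC

theorem card_noncrossingPartitions_map (A : Finset α) (f : α ↪o β) :
    #(noncrossingPartitions S (A.map f.toEmbedding)) = #(noncrossingPartitions S A) := by
  rw [noncrossingPartitions_map, card_map]

theorem isNoncrossing_parts_iff {n : ℕ} (P : Finpartition (univ : Finset (Fin n))) :
    IsNoncrossing univ P.parts ↔ IsCrossingFree P := by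
  constructor
  · intro h U hU V hV hUV a ha c hc b hb d hd hlt
    exact hUV (h.eq_of_crossing U hU V hV a ha b hb c hc d hd hlt.1 hlt.2.1 hlt.2.2)
  · intro h
    refine ⟨fun U => P.nonempty_of_mem_parts, fun x => ⟨P.exists_mem, fun _ => mem_univ x⟩,
      fun U hU V hV x => P.eq_of_mem_parts hU hV, ?_⟩
    intro U hU V hV a ha b hb c hc d hd hab hbc hcd
    by_contra hUV
    exact h U hU V hV hUV a ha c hc b hb d hd ⟨hab, hbc, hcd⟩

theorem count_eq_card_noncrossingPartitions_univ (S : Set ℕ) (n : ℕ) :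
    count S n = #(noncrossingPartitions S (univ : Finset (Fin n))) := by
  rw [count, ← Nat.card_eq_finsetCard]
  refine Nat.card_congr
    { toFun := fun P => ⟨P.1.parts,
        mem_noncrossingPartitions.2 ⟨(isNoncrossing_parts_iff P.1).2 P.2.1, P.2.2⟩⟩
      invFun := fun C =>
        have hC := mem_noncrossingPartitions.1 C.2
        let P : Finpartition (univ : Finset (Fin n)) :=
          .ofExistsUnique C.1 (fun U hU => hC.1.subset hU)
            (fun x hx => by
              obtain ⟨U, hU, hxU⟩ := (hC.1.mem_iff x).1 hx
              exact ⟨U, ⟨hU, hxU⟩, fun V hV => hC.1.eq_of_mem V hV.1 U hU x hV.2 hxU⟩)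
            (fun h => by simpa using hC.1.nonempty ∅ h)
        ⟨P, (isNoncrossing_parts_iff P).1 hC.1, hC.2⟩
      left_inv := fun P => Subtype.ext (Finpartition.ext rfl)
      right_inv := fun C => rfl }

theorem count_eq_card_noncrossingPartitions_range (S : Set ℕ) (n : ℕ) :
    count S n = #(noncrossingPartitions S (range n)) := by
  rw [count_eq_card_noncrossingPartitions_univ,
    ← card_noncrossingPartitions_map _ (Fin.valOrderEmb n)]
  congr 2
  ext x
  simp [Fin.exists_iff]

theorem card_noncrossingPartitions_Ico (S : Set ℕ) (m n : ℕ) :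
    #(noncrossingPartitions S (Ico m n)) = count S (n - m) := by
  have hIco : Ico m n = (range (n - m)).map (OrderEmbedding.addLeft m).toEmbedding := by
    ext x
    simp only [mem_Ico, Finset.mem_map, mem_range]
    exact ⟨fun h => ⟨x - m, by omega, by simp; omega⟩, by rintro ⟨a, h, rfl⟩; simp; omega⟩
  rw [hIco, card_noncrossingPartitions_map, count_eq_card_noncrossingPartitions_range]

theorem count_zero (S : Set ℕ) : count S 0 = 1 := by
  rw [count_eq_card_noncrossingPartitions_range, range_zero, card_eq_one]
  refine ⟨∅, eq_singleton_iff_unique_mem.2 ⟨?_, fun C hC => ?_⟩⟩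
  · exact mem_noncrossingPartitions.2 ⟨isNoncrossing_empty, by simp⟩
  · exact (mem_noncrossingPartitions.1 hC).1.eq_empty

theorem count_eq_zero_of_not_setGcd_dvd {n : ℕ} (hn : ¬ Nat.setGcd S ∣ n) : count S n = 0 := by
  have : IsEmpty {P : Finpartition (univ : Finset (Fin n)) //
      IsCrossingFree P ∧ ∀ B ∈ P.parts, #B ∈ S} := by
    refine ⟨fun ⟨P, _, hS⟩ => hn ?_⟩
    rw [← Fintype.card_fin n, ← card_univ, ← P.sum_card_parts]
    exact dvd_sum fun B hB => Nat.setGcd_dvd_of_mem (hS B hB)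
  exact Nat.card_of_isEmpty

end Partitions

section RootBlock

open Finset

variable {S : Set ℕ} {n j : ℕ} {B : Finset ℕ} {C D : Finset (Finset ℕ)}

/-- `B` is the block of the root `0` (empty if `n = 0`) and `C` the set of the other blocks of a
crossing-free partition of `{0, …, n - 1}`. Separating the block of the root from the others allows
it to be dismantled point by point, without its size having to belong to `S`. -/
structure IsRooted (n : ℕ) (B : Finset ℕ) (C : Finset (Finset ℕ)) : Prop where
  subset : B ⊆ range n
  zero_mem : 0 < n → 0 ∈ B
  isNoncrossing : IsNoncrossing (range n \ B) C
  not_between : ∀ U ∈ C, ∀ a ∈ U, ∀ c ∈ U, ∀ b ∈ B, a < b → ¬ b < c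

namespace IsRooted

theorem notMem (h : IsRooted n B C) (hn : 0 < n) : B ∉ C := fun hB =>
  (mem_sdiff.1 (h.isNoncrossing.subset hB (h.zero_mem hn))).2 (h.zero_mem hn)

theorem lt_of_mem (h : IsRooted n B C) {U : Finset ℕ} (hU : U ∈ C) {x : ℕ} (hx : x ∈ U) : x < n :=
  mem_range.1 (mem_sdiff.1 (h.isNoncrossing.subset hU hx)).1

theorem subset_range_or_subset_Ico (h : IsRooted n B C) (hj : j ∈ B) {U : Finset ℕ} (hU : U ∈ C) :
    U ⊆ range j ∨ U ⊆ Ico (j + 1) n := by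
  have hne : ∀ x ∈ U, x ≠ j := by
    rintro x hx rfl
    exact (mem_sdiff.1 (h.isNoncrossing.subset hU hx)).2 hj
  by_contra! hcon
  obtain ⟨⟨c, hc, hcj⟩, a, ha, haj⟩ := hcon.imp not_subset.1 not_subset.1
  have := h.lt_of_mem hU ha
  have := hne c hc
  have := hne a ha
  simp only [mem_range, mem_Ico] at hcj haj
  exact h.not_between U hU a ha c hc j hj (by omega) (by omega)

theorem insert (h : IsRooted j B C) (hD : IsNoncrossing (Ico (j + 1) n) D) (hj : j < n) :
    IsRooted n (insert j B) (C ∪ D) where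
  subset x hx := by
    have hB : x ∈ B → x < j := fun hx => mem_range.1 (h.subset hx)
    grind
  zero_mem _ := by
    rcases Nat.eq_zero_or_pos j with rfl | hj'
    · exact mem_insert_self _ _
    · exact mem_insert_of_mem (h.zero_mem hj')
  isNoncrossing := by
    have hground : range n \ Insert.insert j B = range j \ B ∪ Ico (j + 1) n := by
      ext x
      have hB : x ∈ B → x < j := fun hx => mem_range.1 (h.subset hx)
      grind
    rw [hground]
    exact h.isNoncrossing.union hD (by grind)
  not_between U hU a ha c hc b hb := by
    rcases mem_union.1 hU with hU | hU
    · rcases mem_insert.1 hb with rfl | hb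
      · exact fun _ => (h.lt_of_mem hU hc).not_gt
      · exact h.not_between U hU a ha c hc b hb
    · have hja : j < a := (mem_Ico.1 (hD.subset hU ha)).1
      have hbj : b ≤ j := by
        rcases mem_insert.1 hb with rfl | hb
        · exact le_rfl
        · exact (mem_range.1 (h.subset hb)).le
      omega

theorem left (h : IsRooted n (Insert.insert j B) C) (hB : ∀ x ∈ B, x < j) :
    IsRooted j B {U ∈ C | U ⊆ range j} where
  subset x hx := mem_range.2 (hB x hx)
  zero_mem h0 := mem_of_mem_insert_of_ne
    (h.zero_mem (h0.trans (mem_range.1 (h.subset (mem_insert_self j B))))) h0.ne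
  isNoncrossing := by
    refine h.isNoncrossing.mono (filter_subset _ _) fun x => ?_
    have hjn := mem_range.1 (h.subset (mem_insert_self j B))
    have hx := h.isNoncrossing.mem_iff x
    have hside := fun U => h.subset_range_or_subset_Ico (mem_insert_self j B) (U := U)
    grind
  not_between U hU a ha c hc b hb :=
    h.not_between U (mem_filter.1 hU).1 a ha c hc b (mem_insert_of_mem hb)

theorem right (h : IsRooted n (Insert.insert j B) C) (hB : ∀ x ∈ B, x < j) :
    IsNoncrossing (Ico (j + 1) n) {U ∈ C | U ⊆ Ico (j + 1) n} := by
  refine h.isNoncrossing.mono (filter_subset _ _) fun x => ?_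
  have hx := h.isNoncrossing.mem_iff x
  have hside := fun U => h.subset_range_or_subset_Ico (mem_insert_self j B) (U := U)
  grind

theorem filter_union_filter (h : IsRooted n B C) (hj : j ∈ B) :
    {U ∈ C | U ⊆ range j} ∪ {U ∈ C | U ⊆ Ico (j + 1) n} = C := by
  rw [← filter_or, filter_true_of_mem]
  exact fun U hU => h.subset_range_or_subset_Ico hj hU

theorem isNoncrossing_insert (h : IsRooted n B C) (hn : 0 < n) :
    IsNoncrossing (range n) (Insert.insert B C) where
  nonempty U hU := by
    rcases mem_insert.1 hU with rfl | hU
    · exact ⟨0, h.zero_mem hn⟩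
    · exact h.isNoncrossing.nonempty U hU
  mem_iff x := by
    have hx := h.isNoncrossing.mem_iff x
    have hB : x ∈ B → x ∈ range n := fun hx => h.subset hx
    grind
  eq_of_mem U hU V hV x hxU hxV := by
    rcases mem_insert.1 hU with rfl | hU' <;> rcases mem_insert.1 hV with rfl | hV'
    · rfl
    · exact absurd hxU (mem_sdiff.1 (h.isNoncrossing.subset hV' hxV)).2
    · exact absurd hxV (mem_sdiff.1 (h.isNoncrossing.subset hU' hxU)).2
    · exact h.isNoncrossing.eq_of_mem U hU' V hV' x hxU hxV
  eq_of_crossing U hU V hV a ha b hb c hc d hd hab hbc hcd := by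
    rcases mem_insert.1 hU with rfl | hU' <;> rcases mem_insert.1 hV with rfl | hV'
    · rfl
    · exact absurd hcd (h.not_between V hV' b hb d hd c hc hbc)
    · exact absurd hbc (h.not_between U hU' a ha c hc b hb hab)
    · exact h.isNoncrossing.eq_of_crossing U hU' V hV' a ha b hb c hc d hd hab hbc hcd

end IsRooted

theorem IsNoncrossing.isRooted_erase (h : IsNoncrossing (range n) C) (hB : B ∈ C) (h0 : 0 ∈ B) :
    IsRooted n B (C.erase B) where
  subset := h.subset hB
  zero_mem _ := h0
  isNoncrossing := by
    refine h.mono (erase_subset _ _) fun x => ?_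
    have hx := h.mem_iff x
    have hdisj := fun U hU => h.eq_of_mem U hU B hB x
    grind
  not_between U hU a ha c hc b hb hab hbc := by
    obtain ⟨hUB, hU⟩ := mem_erase.1 hU
    have ha0 : a ≠ 0 := by
      rintro rfl
      exact hUB (h.eq_of_mem U hU B hB 0 ha h0)
    exact hUB (h.eq_of_crossing B hB U hU 0 h0 a ha b hb c hc ha0.bot_lt hab hbc).symm

open scoped Classical in
/-- The crossing-free partitions of `{0, …, n - 1}` whose block of `0` has size `k`, the other
blocks having sizes in `S`. -/
noncomputable def rootedPartitions (S : Set ℕ) (n k : ℕ) :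
    Finset (Finset ℕ × Finset (Finset ℕ)) :=
  {p ∈ (range n).powerset ×ˢ (range n).powerset.powerset |
    IsRooted n p.1 p.2 ∧ #p.1 = k ∧ ∀ U ∈ p.2, #U ∈ S}

theorem mem_rootedPartitions {k : ℕ} {p : Finset ℕ × Finset (Finset ℕ)} :
    p ∈ rootedPartitions S n k ↔ IsRooted n p.1 p.2 ∧ #p.1 = k ∧ ∀ U ∈ p.2, #U ∈ S := by
  simp only [rootedPartitions, mem_filter, mem_product, mem_powerset, and_iff_right_iff_imp]
  exact fun h => ⟨h.1.subset, fun U hU => mem_powerset.2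
    ((h.1.isNoncrossing.subset hU).trans sdiff_subset)⟩

theorem card_rootedPartitions_zero (S : Set ℕ) (n : ℕ) :
    #(rootedPartitions S n 0) = if n = 0 then 1 else 0 := by
  split_ifs with hn
  · subst hn
    refine card_eq_one.2 ⟨(∅, ∅), eq_singleton_iff_unique_mem.2 ⟨?_, ?_⟩⟩
    · exact mem_rootedPartitions.2
        ⟨⟨by simp, by simp, by simpa using isNoncrossing_empty, by simp⟩, rfl, by simp⟩
    · rintro ⟨B, C⟩ hBC
      obtain ⟨h, hB, -⟩ := mem_rootedPartitions.1 hBC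
      obtain rfl : B = ∅ := card_eq_zero.1 hB
      exact Prod.ext rfl (IsNoncrossing.eq_empty (by simpa using h.isNoncrossing))
  · refine card_eq_zero.2 (eq_empty_of_forall_notMem fun p hp => ?_)
    obtain ⟨h, hB, -⟩ := mem_rootedPartitions.1 hp
    exact (card_pos.2 ⟨0, h.zero_mem (Nat.pos_of_ne_zero hn)⟩).ne' hB

theorem exists_insert_eq_of_card_eq_succ {α : Type*} [LinearOrder α] {B : Finset α} {k : ℕ}
    (hB : #B = k + 1) : ∃ j B', insert j B' = B ∧ ∀ x ∈ B', x < j := by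
  have hne : B.Nonempty := card_pos.1 (by omega)
  exact ⟨B.max' hne, B.erase (B.max' hne), insert_erase (B.max'_mem hne),
    fun x hx => B.lt_max'_of_mem_erase_max' hne hx⟩

theorem IsRooted.eq_of_insert_eq_insert {j' : ℕ} {B' : Finset ℕ} {C' D' : Finset (Finset ℕ)}
    (h : IsRooted j B C) (hD : IsNoncrossing (Ico (j + 1) n) D)
    (h' : IsRooted j' B' C') (hD' : IsNoncrossing (Ico (j' + 1) n) D')
    (hB : Insert.insert j B = Insert.insert j' B') (hCD : C ∪ D = C' ∪ D') :
    j = j' ∧ B = B' ∧ C = C' ∧ D = D' := by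
  have hlt : ∀ x ∈ B, x < j := fun x hx => mem_range.1 (h.subset hx)
  have hlt' : ∀ x ∈ B', x < j' := fun x hx => mem_range.1 (h'.subset hx)
  obtain rfl : j = j' := by
    have hj : j ∈ Insert.insert j' B' := hB ▸ mem_insert_self j B
    have hj' : j' ∈ Insert.insert j B := hB ▸ mem_insert_self j' B'
    grind
  have hdisj : Disjoint (range j) (Ico (j + 1) n) := disjoint_left.2 (by grind)
  refine ⟨rfl, ?_, ?_, ?_⟩
  · rw [← erase_insert fun hj => (hlt j hj).false, hB, erase_insert fun hj => (hlt' j hj).false]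
  · rw [← h.isNoncrossing.filter_subset_union_of_disjoint hD sdiff_subset hdisj, hCD,
      h'.isNoncrossing.filter_subset_union_of_disjoint hD' sdiff_subset hdisj]
  · rw [← hD.filter_subset_union_of_disjoint h.isNoncrossing Subset.rfl
        (hdisj.symm.mono_right sdiff_subset), union_comm, hCD, union_comm,
      hD'.filter_subset_union_of_disjoint h'.isNoncrossing Subset.rfl
        (hdisj.symm.mono_right sdiff_subset)]

theorem card_rootedPartitions_succ (S : Set ℕ) (n k : ℕ) :
    #(rootedPartitions S n (k + 1)) =
      ∑ j ∈ range n, #(rootedPartitions S j k) * count S (n - (j + 1)) := by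
  simp only [← card_noncrossingPartitions_Ico, ← card_product, ← card_sigma]
  symm
  refine card_bij (fun x _ => (insert x.1 x.2.1.1, x.2.1.2 ∪ x.2.2)) ?_ ?_ ?_
  · rintro ⟨j, ⟨B, C⟩, D⟩ hx
    simp only [mem_sigma, mem_range, mem_product, mem_rootedPartitions,
      mem_noncrossingPartitions] at hx ⊢
    obtain ⟨hj, ⟨hR, hk, hC⟩, hD, hDS⟩ := hx
    refine ⟨hR.insert hD hj, ?_, fun U hU => (mem_union.1 hU).elim (hC U) (hDS U)⟩
    rw [card_insert_of_notMem fun hjB => (mem_range.1 (hR.subset hjB)).false, hk]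
  · rintro ⟨j, ⟨B, C⟩, D⟩ hx ⟨j', ⟨B', C'⟩, D'⟩ hx' heq
    simp only [mem_sigma, mem_product, mem_rootedPartitions, mem_noncrossingPartitions,
      Prod.mk.injEq] at hx hx' heq
    obtain ⟨rfl, rfl, rfl, rfl⟩ :=
      hx.2.1.1.eq_of_insert_eq_insert hx.2.2.1 hx'.2.1.1 hx'.2.2.1 heq.1 heq.2
    rfl
  · rintro ⟨E, F⟩ hEF
    obtain ⟨h, hk, hF⟩ := mem_rootedPartitions.1 hEF
    obtain ⟨j, B, rfl, hB⟩ := exists_insert_eq_of_card_eq_succ hk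
    have hj : j ∈ Insert.insert j B := mem_insert_self j B
    refine ⟨⟨j, (B, {U ∈ F | U ⊆ range j}), {U ∈ F | U ⊆ Ico (j + 1) n}⟩, ?_,
      Prod.ext rfl (h.filter_union_filter hj)⟩
    simp only [mem_sigma, mem_product, mem_rootedPartitions, mem_noncrossingPartitions]
    refine ⟨h.subset hj, ⟨h.left hB, ?_, fun U hU => hF U (mem_filter.1 hU).1⟩,
      h.right hB, fun U hU => hF U (mem_filter.1 hU).1⟩
    rwa [card_insert_of_notMem fun hjB => (hB j hjB).false, Nat.add_right_cancel_iff] at hk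

theorem card_rootedPartitions (S : Set ℕ) (n k : ℕ) :
    #(rootedPartitions S n k) = PowerSeries.coeff n ((PowerSeries.X * genFun S) ^ k) := by
  induction k generalizing n with
  | zero => rw [card_rootedPartitions_zero, pow_zero, PowerSeries.coeff_one]
  | succ k ih =>
    rw [card_rootedPartitions_succ, pow_succ', mul_assoc]
    cases n with
    | zero => simp
    | succ n =>
      rw [PowerSeries.coeff_succ_X_mul, mul_comm (genFun S), PowerSeries.coeff_mul,
        Nat.sum_antidiagonal_eq_sum_range_succ_mk]
      refine sum_congr rfl fun j _ => ?_
      rw [ih, genFun, PowerSeries.coeff_mk, Nat.add_sub_add_right]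

open scoped Classical in
theorem count_eq_sum_card_rootedPartitions (S : Set ℕ) {n : ℕ} (hn : 0 < n) :
    count S n = ∑ k ∈ range (n + 1) with k ∈ S, #(rootedPartitions S n k) := by
  rw [← card_sigma, count_eq_card_noncrossingPartitions_range]
  symm
  refine card_bij (fun x _ => insert x.2.1 x.2.2) ?_ ?_ ?_
  · rintro ⟨k, B, C⟩ hx
    simp only [mem_sigma, mem_filter, mem_rootedPartitions, mem_noncrossingPartitions] at hx ⊢
    obtain ⟨⟨-, hk⟩, hR, rfl, hC⟩ := hx
    refine ⟨hR.isNoncrossing_insert hn, fun U hU => ?_⟩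
    rcases mem_insert.1 hU with rfl | hU
    · exact hk
    · exact hC U hU
  · rintro ⟨k, B, C⟩ hx ⟨k', B', C'⟩ hx' heq
    simp only [mem_sigma, mem_rootedPartitions] at hx hx' heq
    obtain ⟨-, hR, rfl, -⟩ := hx
    obtain ⟨-, hR', rfl, -⟩ := hx'
    obtain rfl : B = B' := (hR'.isNoncrossing_insert hn).eq_of_mem B
      (heq ▸ mem_insert_self _ _) B' (mem_insert_self _ _) 0 (hR.zero_mem hn) (hR'.zero_mem hn)
    obtain rfl : C = C' := by
      rw [← erase_insert (hR.notMem hn), heq, erase_insert (hR'.notMem hn)]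
    rfl
  · intro C hC
    obtain ⟨h, hS⟩ := mem_noncrossingPartitions.1 hC
    obtain ⟨B, hB, h0⟩ := (h.mem_iff 0).1 (mem_range.2 hn)
    refine ⟨⟨#B, B, C.erase B⟩, ?_, insert_erase hB⟩
    simp only [mem_sigma, mem_filter, mem_rootedPartitions, mem_range, Nat.lt_succ_iff]
    exact ⟨⟨by simpa using card_le_card (h.subset hB), hS B hB⟩, h.isRooted_erase hB h0, trivial,
      fun U hU => hS U (mem_of_mem_erase hU)⟩

open scoped Classical in
/-- The functional equation `P = 1 + ∑_{s ∈ S} (x P) ^ s`, in which only the terms with `s ≤ N`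
contribute to the coefficients of order at most `N`. -/
theorem coeff_genFun_eq {S : Set ℕ} (hS : 0 ∉ S) {n N : ℕ} (hn : n ≤ N) :
    PowerSeries.coeff n (genFun S) = (if n = 0 then 1 else 0) +
      ∑ k ∈ range (N + 1) with k ∈ S, PowerSeries.coeff n ((PowerSeries.X * genFun S) ^ k) := by
  have hlow : ∀ k, n < k → PowerSeries.coeff n ((PowerSeries.X * genFun S) ^ k) = 0 := by
    intro k hk
    rw [mul_pow, PowerSeries.coeff_X_pow_mul', if_neg hk.not_ge]
  rw [genFun, PowerSeries.coeff_mk, ← genFun]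
  rcases Nat.eq_zero_or_pos n with rfl | hpos
  · rw [if_pos rfl, count_zero, sum_eq_zero, add_zero]
    exact fun k hk => hlow k (Nat.pos_of_ne_zero (by rintro rfl; exact hS (mem_filter.1 hk).2))
  · rw [if_neg hpos.ne', zero_add, count_eq_sum_card_rootedPartitions S hpos]
    simp only [card_rootedPartitions]
    refine sum_subset (filter_subset_filter _ (range_mono (by omega))) fun k hk hk' => hlow k ?_
    grind

end RootBlock

section PowerSums

variable {ι : Type*} {w : ι → ℝ} {e : ι → ℕ} {r t : ℝ}

theorem norm_mul_pow_le_of_mem_Icc (hw : ∀ i, 0 ≤ w i) (ht : t ∈ Set.Icc 0 r) (i : ι) :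
    ‖w i * t ^ e i‖ ≤ w i * r ^ e i := by
  rw [Real.norm_of_nonneg (mul_nonneg (hw i) (pow_nonneg ht.1 _))]
  exact mul_le_mul_of_nonneg_left (pow_le_pow_left₀ ht.1 ht.2 _) (hw i)

theorem exists_hasSum_mul_pow_eq (hw : ∀ i, 0 ≤ w i) (he : ∀ i, e i ≠ 0) (hr : 0 ≤ r)
    (hsum : Summable fun i => w i * r ^ e i) {a : ℝ} (ha : 0 < a)
    (har : a < ∑' i, w i * r ^ e i) :
    ∃ t ∈ Set.Ioo 0 r, HasSum (fun i => w i * t ^ e i) a := by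
  have hcont : ContinuousOn (fun t => ∑' i, w i * t ^ e i) (Set.Icc 0 r) :=
    continuousOn_tsum (fun i => by fun_prop) hsum fun i t ht =>
      norm_mul_pow_le_of_mem_Icc hw ht i
  have hzero : ∑' i, w i * (0 : ℝ) ^ e i = 0 := by simp [he]
  obtain ⟨t, ht, hta⟩ := intermediate_value_Ioo hr hcont ⟨by simpa only [hzero] using ha, har⟩
  have htsum : Summable fun i => w i * t ^ e i :=
    Summable.of_norm_bounded hsum fun i =>
      norm_mul_pow_le_of_mem_Icc hw (Set.Ioo_subset_Icc_self ht) i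
  exact ⟨t, ht, htsum.hasSum_iff.2 hta⟩

theorem summable_pow_mul_pow_of_lt (ht : 0 ≤ t) (htr : t < r) (hsum : Summable fun i => r ^ e i)
    (k : ℕ) : Summable fun i => (e i : ℝ) ^ k * t ^ e i := by
  have hr : 0 < r := ht.trans_lt htr
  have hgeom : Summable fun n : ℕ => (n : ℝ) ^ k * (t / r) ^ n := by
    refine summable_pow_mul_geometric_of_norm_lt_one k ?_
    rw [Real.norm_of_nonneg (by positivity)]
    exact (div_lt_one hr).2 htr
  obtain ⟨C, hC⟩ := hgeom.tendsto_atTop_zero.bddAbove_range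
  refine Summable.of_nonneg_of_le (fun i => by positivity) (fun i => ?_) (hsum.mul_left C)
  calc (e i : ℝ) ^ k * t ^ e i = (e i : ℝ) ^ k * (t / r) ^ e i * r ^ e i := by
        rw [div_pow, mul_assoc, div_mul_cancel₀ _ (pow_ne_zero _ hr.ne')]
    _ ≤ C * r ^ e i := mul_le_mul_of_nonneg_right (hC ⟨e i, rfl⟩) (by positivity)

end PowerSums

/-- The standing assumptions on the set `S` of block sizes. -/
structure IsAdmissible (S : Set ℕ) : Prop where
  nonempty : S.Nonempty
  zero_notMem : 0 ∉ S
  ne_singleton_one : S ≠ {1}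

namespace IsAdmissible

variable {S : Set ℕ}

theorem ne_zero (h : IsAdmissible S) (s : S) : (s : ℕ) ≠ 0 :=
  fun hs => h.zero_notMem (hs ▸ s.2)

theorem sub_one_nonneg (h : IsAdmissible S) (s : S) : (0 : ℝ) ≤ ((s : ℕ) : ℝ) - 1 :=
  sub_nonneg.2 (Nat.one_le_cast.2 (Nat.one_le_iff_ne_zero.2 (h.ne_zero s)))

theorem exists_two_le (h : IsAdmissible S) : ∃ s : S, 2 ≤ (s : ℕ) := by
  by_contra! hlt
  refine h.ne_singleton_one (h.nonempty.subset_singleton_iff.1 fun s hs => ?_)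
  have := hlt ⟨s, hs⟩
  have := h.ne_zero ⟨s, hs⟩
  grind

theorem one_lt_tsum_of_one_lt (h : IsAdmissible S) {r : ℝ} (hr : 0 < r)
    (hsum : Summable fun s : S => r ^ (s : ℕ))
    (hsum' : Summable fun s : S => ((s : ℕ) : ℝ) * r ^ (s : ℕ))
    {s : S} (hs : 1 < (((s : ℕ) : ℝ) - 1) * r ^ (s : ℕ)) :
    Summable (fun s : S => (((s : ℕ) : ℝ) - 1) * r ^ (s : ℕ)) ∧
      1 < ∑' s : S, (((s : ℕ) : ℝ) - 1) * r ^ (s : ℕ) := by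
  have hsub : Summable fun s : S => (((s : ℕ) : ℝ) - 1) * r ^ (s : ℕ) :=
    (hsum'.sub hsum).congr fun s => by ring
  exact ⟨hsub, hs.trans_le <| hsub.le_tsum s fun t _ =>
    mul_nonneg (h.sub_one_nonneg t) (pow_nonneg hr.le _)⟩

theorem exists_radius_of_finite (h : IsAdmissible S) (hfin : S.Finite) :
    ∃ r : ℝ, 0 < r ∧ Summable (fun s : S => r ^ (s : ℕ)) ∧
      Summable (fun s : S => ((s : ℕ) : ℝ) * r ^ (s : ℕ)) ∧
      ∃ s : S, 1 < (((s : ℕ) : ℝ) - 1) * r ^ (s : ℕ) := by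
  obtain ⟨s, hs⟩ := h.exists_two_le
  have := hfin.to_subtype
  refine ⟨2, two_pos, Summable.of_finite, Summable.of_finite, s, ?_⟩
  have hcast : (2 : ℝ) ≤ (s : ℕ) := by exact_mod_cast hs
  have hpow : (2 : ℝ) ^ 2 ≤ 2 ^ (s : ℕ) := pow_le_pow_right₀ one_le_two hs
  nlinarith

theorem exists_radius_of_infinite (hinf : S.Infinite) :
    ∃ r : ℝ, 0 < r ∧ Summable (fun s : S => r ^ (s : ℕ)) ∧
      Summable (fun s : S => ((s : ℕ) : ℝ) * r ^ (s : ℕ)) ∧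
      ∃ s : S, 1 < (((s : ℕ) : ℝ) - 1) * r ^ (s : ℕ) := by
  obtain ⟨s, hs, hs3⟩ := hinf.exists_gt 3
  have hr₀ : (0 : ℝ) < (1 / 2 : ℝ) ^ (s : ℝ)⁻¹ := Real.rpow_pos_of_pos (by norm_num) _
  have hr₁ : (1 / 2 : ℝ) ^ (s : ℝ)⁻¹ < 1 :=
    Real.rpow_lt_one (by norm_num) (by norm_num) (by positivity)
  have hrs : ((1 / 2 : ℝ) ^ (s : ℝ)⁻¹) ^ s = 1 / 2 :=
    Real.rpow_inv_natCast_pow (by norm_num) (by lia)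
  refine ⟨_, hr₀, (summable_geometric_of_lt_one hr₀.le hr₁).comp_injective
    Subtype.val_injective, ?_, ⟨s, hs⟩, ?_⟩
  · have hgeom := summable_pow_mul_geometric_of_norm_lt_one 1
      ((Real.norm_of_nonneg hr₀.le).trans_lt hr₁)
    simp only [pow_one] at hgeom
    exact hgeom.comp_injective Subtype.val_injective
  · have hcast : (3 : ℝ) < s := by exact_mod_cast hs3
    rw [hrs]
    linarith

theorem exists_isTau_lt (h : IsAdmissible S) :
    ∃ t r : ℝ, IsTau S t ∧ t < r ∧ Summable fun s : S => r ^ (s : ℕ) := by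
  obtain ⟨r, hr, hsum, hsum', s, hs⟩ : ∃ r : ℝ, 0 < r ∧ Summable (fun s : S => r ^ (s : ℕ)) ∧
      Summable (fun s : S => ((s : ℕ) : ℝ) * r ^ (s : ℕ)) ∧
      ∃ s : S, 1 < (((s : ℕ) : ℝ) - 1) * r ^ (s : ℕ) :=
    S.finite_or_infinite.elim h.exists_radius_of_finite exists_radius_of_infinite
  obtain ⟨hsub, hlt⟩ := h.one_lt_tsum_of_one_lt hr hsum hsum' hs
  obtain ⟨t, ht, hta⟩ :=
    exists_hasSum_mul_pow_eq h.sub_one_nonneg h.ne_zero hr.le hsub one_pos hlt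
  exact ⟨t, r, ⟨ht.1, hta⟩, ht.2, hsum⟩

theorem not_isTau_of_lt (h : IsAdmissible S) {t u : ℝ} (ht : IsTau S t) (htu : t < u) :
    ¬ IsTau S u := by
  intro hu
  obtain ⟨s, hs⟩ := h.exists_two_le
  have hcast : (2 : ℝ) ≤ (s : ℕ) := by exact_mod_cast hs
  refine lt_irrefl (1 : ℝ) (hasSum_lt (i := s) (fun x => ?_) ?_ ht.2 hu.2)
  · exact mul_le_mul_of_nonneg_left (pow_le_pow_left₀ ht.1.le htu.le _) (h.sub_one_nonneg x)
  · exact mul_lt_mul_of_pos_left (pow_lt_pow_left₀ htu ht.1.le (h.ne_zero s)) (by linarith)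

theorem existsUnique_isTau (h : IsAdmissible S) : ∃! t : ℝ, IsTau S t := by
  obtain ⟨t, -, ht, -⟩ := h.exists_isTau_lt
  exact ⟨t, ht, fun u hu => le_antisymm (not_lt.1 fun htu => h.not_isTau_of_lt ht htu hu)
    (not_lt.1 fun hut => h.not_isTau_of_lt hu hut ht)⟩

theorem isTau_tau (h : IsAdmissible S) : IsTau S (tau S) :=
  Classical.epsilon_spec h.existsUnique_isTau.exists

theorem tau_pos (h : IsAdmissible S) : 0 < tau S := h.isTau_tau.1

theorem hasSum_sub_one_mul_tau_pow (h : IsAdmissible S) :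
    HasSum (fun s : S => (((s : ℕ) : ℝ) - 1) * tau S ^ (s : ℕ)) 1 := h.isTau_tau.2

theorem exists_tau_lt_summable (h : IsAdmissible S) :
    ∃ r, tau S < r ∧ Summable fun s : S => r ^ (s : ℕ) := by
  obtain ⟨t, r, ht, htr, hsum⟩ := h.exists_isTau_lt
  exact ⟨r, h.existsUnique_isTau.unique ht h.isTau_tau ▸ htr, hsum⟩

theorem summable_pow_mul_tau_pow (h : IsAdmissible S) (k : ℕ) :
    Summable fun s : S => ((s : ℕ) : ℝ) ^ k * tau S ^ (s : ℕ) := by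
  obtain ⟨r, htr, hsum⟩ := h.exists_tau_lt_summable
  exact summable_pow_mul_pow_of_lt h.tau_pos.le htr hsum k

theorem summable_tau_pow (h : IsAdmissible S) : Summable fun s : S => tau S ^ (s : ℕ) :=
  (h.summable_pow_mul_tau_pow 0).congr fun s => by rw [pow_zero, one_mul]

theorem summable_mul_tau_pow (h : IsAdmissible S) :
    Summable fun s : S => ((s : ℕ) : ℝ) * tau S ^ (s : ℕ) :=
  (h.summable_pow_mul_tau_pow 1).congr fun s => by rw [pow_one]

theorem summable_mul_sub_one_mul_tau_pow (h : IsAdmissible S) :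
    Summable fun s : S => ((s : ℕ) : ℝ) * (((s : ℕ) : ℝ) - 1) * tau S ^ (s : ℕ) :=
  ((h.summable_pow_mul_tau_pow 2).sub (h.summable_pow_mul_tau_pow 1)).congr fun s => by ring

theorem hasSum_tau_pow (h : IsAdmissible S) :
    HasSum (fun s : S => tau S ^ (s : ℕ)) (alpha S - 1) := by
  rw [alpha, add_sub_cancel_left]
  exact h.summable_tau_pow.hasSum

theorem hasSum_mul_tau_pow (h : IsAdmissible S) :
    HasSum (fun s : S => ((s : ℕ) : ℝ) * tau S ^ (s : ℕ)) (alpha S) := by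
  have hadd := h.hasSum_sub_one_mul_tau_pow.add h.hasSum_tau_pow
  rw [add_sub_cancel] at hadd
  exact hadd.congr_fun fun s => by ring

theorem one_lt_alpha (h : IsAdmissible S) : 1 < alpha S := by
  obtain ⟨s, hs⟩ := h.nonempty
  have hle := le_hasSum h.hasSum_tau_pow ⟨s, hs⟩ fun t _ => pow_nonneg h.tau_pos.le _
  linarith [pow_pos h.tau_pos s]

theorem alpha_pos (h : IsAdmissible S) : 0 < alpha S := one_pos.trans h.one_lt_alpha

theorem rho_eq (h : IsAdmissible S) : rho S = tau S / alpha S := by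
  rw [rho, h.hasSum_mul_tau_pow.tsum_eq]

theorem rho_pos (h : IsAdmissible S) : 0 < rho S := by
  rw [h.rho_eq]
  exact div_pos h.tau_pos h.alpha_pos

theorem rho_mul_alpha (h : IsAdmissible S) : rho S * alpha S = tau S := by
  rw [h.rho_eq, div_mul_cancel₀ _ h.alpha_pos.ne']

theorem tsum_mul_sub_one_mul_tau_pow_pos (h : IsAdmissible S) :
    0 < ∑' s : S, ((s : ℕ) : ℝ) * (((s : ℕ) : ℝ) - 1) * tau S ^ (s : ℕ) := by
  obtain ⟨s, hs⟩ := h.exists_two_le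
  have hcast : (2 : ℝ) ≤ (s : ℕ) := by exact_mod_cast hs
  refine h.summable_mul_sub_one_mul_tau_pow.tsum_pos (fun t => ?_) s ?_
  · exact mul_nonneg (mul_nonneg (Nat.cast_nonneg _) (h.sub_one_nonneg t))
      (pow_nonneg h.tau_pos.le _)
  · exact mul_pos (mul_pos (by linarith) (by linarith)) (pow_pos h.tau_pos _)

theorem beta_eq (h : IsAdmissible S) : beta S = Real.sqrt (2 * alpha S ^ 3 /
    ∑' s : S, ((s : ℕ) : ℝ) * (((s : ℕ) : ℝ) - 1) * tau S ^ (s : ℕ)) := by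
  rw [beta, h.hasSum_mul_tau_pow.tsum_eq]

theorem beta_pos (h : IsAdmissible S) : 0 < beta S := by
  rw [h.beta_eq]
  exact Real.sqrt_pos.2 (div_pos (mul_pos two_pos (pow_pos h.alpha_pos 3))
    h.tsum_mul_sub_one_mul_tau_pow_pos)

end IsAdmissible

section PartialEval

open Finset

/-- The evaluation at `x` of the terms of degree less than `N` of a power series. -/
noncomputable def partialEval (A : PowerSeries ℕ) (N : ℕ) (x : ℝ) : ℝ :=
  ∑ n ∈ range N, ((PowerSeries.coeff n A : ℕ) : ℝ) * x ^ n

variable {x : ℝ}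

theorem partialEval_nonneg (A : PowerSeries ℕ) (N : ℕ) (hx : 0 ≤ x) : 0 ≤ partialEval A N x :=
  sum_nonneg fun n _ => by positivity

theorem partialEval_one_le (N : ℕ) (x : ℝ) : partialEval 1 N x ≤ 1 := by
  simp only [partialEval, PowerSeries.coeff_one, Nat.cast_ite, Nat.cast_one, Nat.cast_zero,
    ite_mul, one_mul, zero_mul, sum_ite_eq', pow_zero]
  split_ifs <;> norm_num

theorem partialEval_mul_le (A B : PowerSeries ℕ) (N : ℕ) (hx : 0 ≤ x) :
    partialEval (A * B) N x ≤ partialEval A N x * partialEval B N x := by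
  let a (n : ℕ) : ℝ := ((PowerSeries.coeff n A : ℕ) : ℝ) * x ^ n
  let b (n : ℕ) : ℝ := ((PowerSeries.coeff n B : ℕ) : ℝ) * x ^ n
  have coeff_mul_eq : ∀ m, ((PowerSeries.coeff m (A * B) : ℕ) : ℝ) * x ^ m =
      ∑ k ∈ range (m + 1), a k * b (m - k) := by
    intro m
    rw [PowerSeries.coeff_mul, Finset.Nat.sum_antidiagonal_eq_sum_range_succ_mk, Nat.cast_sum,
      sum_mul]
    refine sum_congr rfl fun k hk => ?_
    have hkm : k + (m - k) = m := Nat.add_sub_of_le (Nat.lt_succ_iff.1 (mem_range.1 hk))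
    rw [Nat.cast_mul, mul_mul_mul_comm, ← pow_add, hkm]
  calc partialEval (A * B) N x = ∑ k ∈ range N, ∑ l ∈ range (N - k), a k * b l := by
        rw [partialEval, sum_congr rfl fun m _ => coeff_mul_eq m,
          sum_range_diag_flip N fun k l => a k * b l]
    _ ≤ ∑ k ∈ range N, ∑ l ∈ range N, a k * b l :=
        sum_le_sum fun k _ => sum_le_sum_of_subset_of_nonneg (range_mono (Nat.sub_le _ _))
          fun l _ _ => by positivity
    _ = partialEval A N x * partialEval B N x := (sum_mul_sum _ _ _ _).symm

theorem partialEval_pow_le (A : PowerSeries ℕ) (N : ℕ) (hx : 0 ≤ x) (k : ℕ) :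
    partialEval (A ^ k) N x ≤ partialEval A N x ^ k := by
  induction k with
  | zero => simpa only [pow_zero] using partialEval_one_le N x
  | succ k ih =>
    rw [pow_succ, pow_succ]
    exact (partialEval_mul_le _ _ N hx).trans
      (mul_le_mul_of_nonneg_right ih (partialEval_nonneg A N hx))

theorem partialEval_X_mul (A : PowerSeries ℕ) (N : ℕ) (x : ℝ) :
    partialEval (PowerSeries.X * A) (N + 1) x = x * partialEval A N x := by
  rw [partialEval, sum_range_succ', partialEval, mul_sum]
  simp only [PowerSeries.coeff_succ_X_mul, PowerSeries.coeff_zero_X_mul, Nat.cast_zero, zero_mul,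
    add_zero]
  exact sum_congr rfl fun n _ => by ring

variable {S : Set ℕ}

open scoped Classical in
theorem partialEval_genFun (hS : 0 ∉ S) (N : ℕ) (x : ℝ) :
    partialEval (genFun S) (N + 1) x =
      1 + ∑ k ∈ range (N + 1) with k ∈ S,
        partialEval ((PowerSeries.X * genFun S) ^ k) (N + 1) x := by
  have expand : ∀ n ∈ range (N + 1), ((PowerSeries.coeff n (genFun S) : ℕ) : ℝ) * x ^ n =
      (if n = 0 then 1 else 0) + ∑ k ∈ range (N + 1) with k ∈ S,
        ((PowerSeries.coeff n ((PowerSeries.X * genFun S) ^ k) : ℕ) : ℝ) * x ^ n := by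
    intro n hn
    rw [coeff_genFun_eq hS (Nat.lt_succ_iff.1 (mem_range.1 hn)), Nat.cast_add, Nat.cast_sum,
      add_mul, sum_mul]
    congr 1
    split_ifs with hn
    · rw [hn, pow_zero, mul_one, Nat.cast_one]
    · rw [Nat.cast_zero, zero_mul]
  simp only [partialEval]
  rw [sum_congr rfl expand, sum_add_distrib, sum_ite_eq', if_pos (mem_range.2 N.succ_pos),
    sum_comm]

open scoped Classical in
theorem IsAdmissible.sum_tau_pow_le (h : IsAdmissible S) (N : ℕ) :
    ∑ k ∈ range N with k ∈ S, tau S ^ k ≤ alpha S - 1 := by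
  have hsum := hasSum_subtype_iff_indicator.1 h.hasSum_tau_pow
  have hle := sum_le_hasSum (range N)
    (fun k _ => Set.indicator_nonneg (fun k _ => pow_nonneg h.tau_pos.le k) k) hsum
  simpa only [sum_filter, Set.indicator_apply] using hle

/- Bootstrap: if the partial sums of degree less than `N` of `P (ρ)` are at most `α`, then those of
`(ρ P (ρ)) ^ k` of degree at most `N` are at most `(ρ α) ^ k = τ ^ k`, and `1 + ∑ τ ^ k = α`. -/
theorem IsAdmissible.partialEval_genFun_le (h : IsAdmissible S) (N : ℕ) :
    partialEval (genFun S) N (rho S) ≤ alpha S := by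
  induction N with
  | zero => simpa only [partialEval, range_zero, sum_empty] using h.alpha_pos.le
  | succ N ih =>
    have hpow : ∀ k, partialEval ((PowerSeries.X * genFun S) ^ k) (N + 1) (rho S) ≤ tau S ^ k := by
      intro k
      refine (partialEval_pow_le _ _ h.rho_pos.le k).trans ?_
      rw [partialEval_X_mul, ← h.rho_mul_alpha]
      exact pow_le_pow_left₀ (mul_nonneg h.rho_pos.le (partialEval_nonneg _ _ h.rho_pos.le))
        (mul_le_mul_of_nonneg_left ih h.rho_pos.le) k
    classical
    rw [partialEval_genFun h.zero_notMem]
    linarith [sum_le_sum fun k (_ : k ∈ (range (N + 1)).filter (· ∈ S)) => hpow k,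
      h.sum_tau_pow_le (N + 1)]

theorem IsAdmissible.partialEval_X_mul_genFun_pow_le (h : IsAdmissible S) (k N : ℕ) :
    partialEval ((PowerSeries.X * genFun S) ^ k) N (rho S) ≤ tau S ^ k := by
  refine (partialEval_pow_le _ _ h.rho_pos.le k).trans
    (pow_le_pow_left₀ (partialEval_nonneg _ _ h.rho_pos.le) ?_ k)
  cases N with
  | zero => simpa only [partialEval, range_zero, sum_empty] using h.tau_pos.le
  | succ N =>
    rw [partialEval_X_mul, ← h.rho_mul_alpha]
    exact mul_le_mul_of_nonneg_left (h.partialEval_genFun_le N) h.rho_pos.le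

end PartialEval

/-- The power series `A` converges absolutely at `x`, with sum `v`. -/
structure HasAbsEval (A : PowerSeries ℕ) (x v : ℂ) : Prop where
  summable_norm : Summable fun n => ‖((PowerSeries.coeff n A : ℕ) : ℂ) * x ^ n‖
  hasSum : HasSum (fun n => ((PowerSeries.coeff n A : ℕ) : ℂ) * x ^ n) v

namespace HasAbsEval

variable {A B : PowerSeries ℕ} {x v w : ℂ}

theorem of_coeff_eq_zero (k : ℕ) (hA : ∀ n ≠ k, PowerSeries.coeff n A = 0) :
    HasAbsEval A x (((PowerSeries.coeff k A : ℕ) : ℂ) * x ^ k) := by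
  have hzero : ∀ n ≠ k, ((PowerSeries.coeff n A : ℕ) : ℂ) * x ^ n = 0 := fun n hn => by
    rw [hA n hn, Nat.cast_zero, zero_mul]
  exact ⟨(hasSum_single k fun n hn => by rw [hzero n hn, norm_zero]).summable,
    hasSum_single k hzero⟩

theorem one : HasAbsEval 1 x 1 := by
  simpa using of_coeff_eq_zero (A := 1) (x := x) 0 fun n hn => by
    rw [PowerSeries.coeff_one, if_neg hn]

theorem X : HasAbsEval PowerSeries.X x x := by
  simpa using of_coeff_eq_zero (A := PowerSeries.X) (x := x) 1 fun n hn => by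
    rw [PowerSeries.coeff_X, if_neg hn]

theorem mul (hA : HasAbsEval A x v) (hB : HasAbsEval B x w) : HasAbsEval (A * B) x (v * w) := by
  have coeff_mul_eq : ∀ n, ((PowerSeries.coeff n (A * B) : ℕ) : ℂ) * x ^ n =
      ∑ kl ∈ Finset.HasAntidiagonal.antidiagonal n,
        (((PowerSeries.coeff kl.1 A : ℕ) : ℂ) * x ^ kl.1) *
          (((PowerSeries.coeff kl.2 B : ℕ) : ℂ) * x ^ kl.2) := by
    intro n
    rw [PowerSeries.coeff_mul, Nat.cast_sum, Finset.sum_mul]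
    refine Finset.sum_congr rfl fun kl hkl => ?_
    rw [Nat.cast_mul, mul_mul_mul_comm, ← pow_add, Finset.HasAntidiagonal.mem_antidiagonal.1 hkl]
  have hnorm : Summable fun n => ‖((PowerSeries.coeff n (A * B) : ℕ) : ℂ) * x ^ n‖ :=
    (summable_norm_sum_mul_antidiagonal_of_summable_norm hA.summable_norm
      hB.summable_norm).congr fun n => by rw [coeff_mul_eq]
  refine ⟨hnorm, hnorm.of_norm.hasSum_iff.2 ?_⟩
  rw [tsum_congr coeff_mul_eq, ← tsum_mul_tsum_eq_tsum_sum_antidiagonal_of_summable_norm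
    hA.summable_norm hB.summable_norm, hA.hasSum.tsum_eq, hB.hasSum.tsum_eq]

theorem pow (hA : HasAbsEval A x v) (k : ℕ) : HasAbsEval (A ^ k) x (v ^ k) := by
  induction k with
  | zero => simpa only [pow_zero] using one
  | succ k ih => simpa only [pow_succ] using ih.mul hA

end HasAbsEval

section FunctionalEquation

variable {S : Set ℕ} {x : ℂ}

open scoped Classical in
theorem hasSum_coeff_X_mul_genFun_pow (hS : 0 ∉ S) (n : ℕ) (x : ℂ) :
    HasSum (fun s : S =>
        ((PowerSeries.coeff n ((PowerSeries.X * genFun S) ^ (s : ℕ)) : ℕ) : ℂ) * x ^ n)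
      (((PowerSeries.coeff n (genFun S) : ℕ) : ℂ) * x ^ n - if n = 0 then 1 else 0) := by
  have hsum : ((PowerSeries.coeff n (genFun S) : ℕ) : ℂ) * x ^ n - (if n = 0 then 1 else 0) =
      ∑ k ∈ Finset.range (n + 1), S.indicator (fun k =>
        ((PowerSeries.coeff n ((PowerSeries.X * genFun S) ^ k) : ℕ) : ℂ) * x ^ n) k := by
    simp only [Set.indicator_apply, ← Finset.sum_filter]
    rw [coeff_genFun_eq hS le_rfl, Nat.cast_add, Nat.cast_sum, add_mul, Finset.sum_mul,
      sub_eq_iff_eq_add']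
    congr 1
    split_ifs with hn
    · rw [hn, pow_zero, mul_one, Nat.cast_one]
    · rw [Nat.cast_zero, zero_mul]
  rw [hsum]
  refine hasSum_subtype_iff_indicator.2 (hasSum_sum_of_ne_finset_zero fun k hk => ?_)
  refine Set.indicator_apply_eq_zero.2 fun _ => ?_
  rw [mul_pow, PowerSeries.coeff_X_pow_mul', if_neg (by simpa using hk), Nat.cast_zero, zero_mul]

theorem norm_coeff_mul_pow_le {r : ℝ} (hx : ‖x‖ ≤ r) (A : PowerSeries ℕ) (n : ℕ) :
    ‖((PowerSeries.coeff n A : ℕ) : ℂ) * x ^ n‖ ≤ ((PowerSeries.coeff n A : ℕ) : ℝ) * r ^ n := by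
  rw [norm_mul, norm_pow, Complex.norm_natCast]
  exact mul_le_mul_of_nonneg_left (pow_le_pow_left₀ (norm_nonneg x) hx n) (Nat.cast_nonneg _)

namespace IsAdmissible

theorem summable_coeff_genFun (h : IsAdmissible S) :
    Summable fun n => ((PowerSeries.coeff n (genFun S) : ℕ) : ℝ) * rho S ^ n :=
  summable_of_sum_range_le (fun n => mul_nonneg (Nat.cast_nonneg _) (pow_nonneg h.rho_pos.le n))
    h.partialEval_genFun_le

theorem tsum_coeff_genFun_le (h : IsAdmissible S) :
    ∑' n, ((PowerSeries.coeff n (genFun S) : ℕ) : ℝ) * rho S ^ n ≤ alpha S :=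
  Real.tsum_le_of_sum_range_le
    (fun n => mul_nonneg (Nat.cast_nonneg _) (pow_nonneg h.rho_pos.le n)) h.partialEval_genFun_le

theorem hasAbsEval_genFun (h : IsAdmissible S) (hx : ‖x‖ ≤ rho S) :
    HasAbsEval (genFun S) x (∑' n, ((PowerSeries.coeff n (genFun S) : ℕ) : ℂ) * x ^ n) := by
  have hnorm := Summable.of_nonneg_of_le (fun n => norm_nonneg _)
    (norm_coeff_mul_pow_le hx (genFun S)) h.summable_coeff_genFun
  exact ⟨hnorm, hnorm.of_norm.hasSum⟩

theorem summable_coeff_X_mul_genFun_pow (h : IsAdmissible S) (hx : ‖x‖ ≤ rho S) :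
    Summable fun p : S × ℕ =>
      ((PowerSeries.coeff p.2 ((PowerSeries.X * genFun S) ^ (p.1 : ℕ)) : ℕ) : ℂ) * x ^ p.2 := by
  have hnonneg : ∀ k n : ℕ, 0 ≤
      ((PowerSeries.coeff n ((PowerSeries.X * genFun S) ^ k) : ℕ) : ℝ) * rho S ^ n :=
    fun k n => mul_nonneg (Nat.cast_nonneg _) (pow_nonneg h.rho_pos.le n)
  have hsum : Summable fun p : S × ℕ =>
      ((PowerSeries.coeff p.2 ((PowerSeries.X * genFun S) ^ (p.1 : ℕ)) : ℕ) : ℝ) *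
        rho S ^ p.2 := by
    refine (summable_prod_of_nonneg fun p : S × ℕ => hnonneg p.1 p.2).2 ⟨fun s => ?_, ?_⟩
    · exact summable_of_sum_range_le (hnonneg s) (h.partialEval_X_mul_genFun_pow_le s)
    · exact Summable.of_nonneg_of_le (fun s => tsum_nonneg (hnonneg s))
        (fun s => Real.tsum_le_of_sum_range_le (hnonneg s)
          (h.partialEval_X_mul_genFun_pow_le s)) h.summable_tau_pow
  exact Summable.of_norm_bounded hsum fun p => norm_coeff_mul_pow_le hx _ _

theorem hasSum_mul_genFun_pow (h : IsAdmissible S) (hx : ‖x‖ ≤ rho S) :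
    HasSum (fun s : S =>
        (x * ∑' n, ((PowerSeries.coeff n (genFun S) : ℕ) : ℂ) * x ^ n) ^ (s : ℕ))
      (∑' n, ((PowerSeries.coeff n (genFun S) : ℕ) : ℂ) * x ^ n - 1) := by
  have hP := h.hasAbsEval_genFun hx
  have hdouble := (h.summable_coeff_X_mul_genFun_pow hx).hasSum
  have sum_by_block := hdouble.prod_fiberwise fun s => ((HasAbsEval.X.mul hP).pow s).hasSum
  have sum_by_degree := ((Equiv.prodComm ℕ S).hasSum_iff.2 hdouble).prod_fiberwise fun n =>
    hasSum_coeff_X_mul_genFun_pow h.zero_notMem n x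
  rwa [sum_by_degree.unique (hP.hasSum.sub (hasSum_ite_eq 0 1))] at sum_by_block

end IsAdmissible

end FunctionalEquation

section Sqrt

/-- The Taylor coefficients of `(1 - z) ^ a` at `0`. -/
noncomputable def binomCoeff (a : ℝ) (n : ℕ) : ℝ := (-1) ^ n * Ring.choose a n

theorem hasSum_binomCoeff (a : ℝ) {z : ℂ} (hz : ‖z‖ < 1) :
    HasSum (fun n => (binomCoeff a n : ℂ) * z ^ n) ((1 - z) ^ (a : ℂ)) := by
  have hmem : -z ∈ Metric.eball (0 : ℂ) 1 := by
    rwa [Metric.mem_eball, edist_zero_right, enorm_neg, ← ofReal_norm, ENNReal.ofReal_lt_one]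
  have hbinom := (Complex.one_add_cpow_hasFPowerSeriesOnBall_zero (a := a)).hasSum hmem
  rw [zero_add, ← sub_eq_add_neg] at hbinom
  refine hbinom.congr_fun fun n => ?_
  rw [binomCoeff, binomialSeries_apply, List.ofFn_const, List.prod_replicate, neg_pow z,
    Complex.ofReal_mul, Complex.ofReal_choose, smul_eq_mul]
  push_cast
  ring

theorem binomCoeff_zero (a : ℝ) : binomCoeff a 0 = 1 := by
  rw [binomCoeff, pow_zero, one_mul, Ring.choose_zero_right]

theorem succ_mul_binomCoeff_succ (a : ℝ) (n : ℕ) :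
    (n + 1) * binomCoeff a (n + 1) = (n - a) * binomCoeff a n := by
  have hchoose := Ring.choose_smul_choose a (Nat.le_succ n)
  rw [Nat.succ_sub (le_refl n), Nat.sub_self, Ring.choose_one_right, Nat.succ_eq_add_one,
    Nat.choose_succ_self_right, nsmul_eq_mul, Nat.cast_succ] at hchoose
  simp only [binomCoeff]
  rw [pow_succ]
  linear_combination (-(-1 : ℝ) ^ n) * hchoose

theorem prod_neg_add_eq_factorial_mul_binomCoeff (a : ℝ) (n : ℕ) :
    ∏ j ∈ Finset.range n, (-a + (j : ℝ)) = n.factorial * binomCoeff a n := by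
  induction n with
  | zero => rw [Finset.prod_range_zero, binomCoeff_zero, Nat.factorial_zero, Nat.cast_one, one_mul]
  | succ n ih =>
    rw [Finset.prod_range_succ, ih, Nat.factorial_succ, Nat.cast_mul, Nat.cast_succ]
    linear_combination (-(n.factorial : ℝ)) * succ_mul_binomCoeff_succ a n

theorem binomCoeff_mul_rpow_eq {a : ℝ} {n : ℕ} (hn : n ≠ 0) (ha : a ≠ n) :
    binomCoeff a n * (n : ℝ) ^ (a + 1) = (Real.GammaSeq (-a) n)⁻¹ * (n / (n + -a)) := by
  have hpos : (0 : ℝ) < n := Nat.cast_pos.2 (Nat.pos_of_ne_zero hn)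
  have hfact : (n.factorial : ℝ) ≠ 0 := Nat.cast_ne_zero.2 n.factorial_ne_zero
  have hrpow : (n : ℝ) ^ a ≠ 0 := (Real.rpow_pos_of_pos hpos _).ne'
  have hshift : (n : ℝ) + -a ≠ 0 := by
    rw [← sub_eq_add_neg]
    exact sub_ne_zero.2 ha.symm
  rw [Real.GammaSeq, Finset.prod_range_succ, prod_neg_add_eq_factorial_mul_binomCoeff,
    add_comm (-a), Real.rpow_add_one hpos.ne', Real.rpow_neg hpos.le]
  field_simp

theorem tendsto_binomCoeff_mul_rpow {a : ℝ} (ha : ∀ m : ℕ, a ≠ m) :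
    Tendsto (fun n : ℕ => binomCoeff a n * (n : ℝ) ^ (a + 1)) atTop
      (𝓝 (Real.Gamma (-a))⁻¹) := by
  have hne : Real.Gamma (-a) ≠ 0 := Real.Gamma_ne_zero fun m h => ha m (neg_injective h)
  have hlim := ((Real.GammaSeq_tendsto_Gamma (-a)).inv₀ hne).mul
    (tendsto_natCast_div_add_atTop (𝕜 := ℝ) (-a))
  rw [mul_one] at hlim
  refine hlim.congr' ?_
  filter_upwards [eventually_ne_atTop 0] with n hn
  exact (binomCoeff_mul_rpow_eq hn (ha n)).symm

theorem tendsto_binomCoeff_mul_rpow_of_lt {a b : ℝ} (ha : ∀ m : ℕ, a ≠ m) (hb : b < a + 1) :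
    Tendsto (fun n : ℕ => binomCoeff a n * (n : ℝ) ^ b) atTop (𝓝 0) := by
  have hdecay : Tendsto (fun n : ℕ => (n : ℝ) ^ (-(a + 1 - b))) atTop (𝓝 0) :=
    (tendsto_rpow_neg_atTop (sub_pos.2 hb)).comp tendsto_natCast_atTop_atTop
  have hlim := (tendsto_binomCoeff_mul_rpow ha).mul hdecay
  rw [mul_zero] at hlim
  refine hlim.congr' ?_
  filter_upwards [eventually_gt_atTop 0] with n hn
  rw [mul_assoc, ← Real.rpow_add (Nat.cast_pos.2 hn), neg_sub, add_sub_cancel]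

theorem gamma_neg_half : Real.Gamma (-(1 / 2)) = -(2 * √Real.pi) := by
  have hrec := Real.Gamma_add_one (s := -(1 / 2)) (by norm_num)
  rw [show (-(1 / 2) + 1 : ℝ) = 1 / 2 by norm_num, Real.Gamma_one_half_eq] at hrec
  linarith

theorem natCast_div_two_ne_natCast {k : ℕ} (hk : Odd k) (m : ℕ) : (k / 2 : ℝ) ≠ m := by
  rw [Ne, div_eq_iff two_ne_zero]
  norm_cast
  rintro rfl
  exact (Nat.not_odd_iff_even.2 (even_two.mul_left m)) hk

theorem sqrt_pow_eq_cpow (z : ℂ) (k : ℕ) : Complex.sqrt z ^ k = z ^ ((k / 2 : ℝ) : ℂ) := by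
  rw [Complex.sqrt, ← Complex.cpow_nat_mul]
  push_cast
  rfl

theorem sqrt_sq (z : ℂ) : Complex.sqrt z ^ 2 = z :=
  Complex.cpow_nat_inv_pow z two_ne_zero

theorem sqrt_ne_zero {z : ℂ} (hz : z ≠ 0) : Complex.sqrt z ≠ 0 := by
  rw [← sqrt_sq z] at hz
  exact ne_zero_pow two_ne_zero hz

theorem norm_sqrt_sq (z : ℂ) : ‖Complex.sqrt z‖ ^ 2 = ‖z‖ := by
  rw [← norm_pow, sqrt_sq]

theorem hasDerivAt_sqrt_one_sub {z : ℂ} (hz : 1 - z ∈ Complex.slitPlane) :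
    HasDerivAt (fun z => Complex.sqrt (1 - z)) (-(1 / (2 * Complex.sqrt (1 - z)))) z := by
  have hcpow : (1 - z) ^ (-1 / 2 : ℂ) = (Complex.sqrt (1 - z))⁻¹ := by
    rw [Complex.sqrt, ← Complex.cpow_neg, neg_div, one_div]
  refine ((Complex.hasDerivAt_sqrt hz).comp z ((hasDerivAt_id z).const_sub 1)).congr_deriv ?_
  rw [hcpow, mul_neg, mul_one, one_div, mul_inv, div_eq_inv_mul]

theorem analyticAt_sqrt_comp {H : ℂ → ℂ} {x : ℂ} (hH : AnalyticAt ℂ H x)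
    (h : H x ∈ Complex.slitPlane) : AnalyticAt ℂ (fun s => Complex.sqrt (H s)) x :=
  hH.cpow analyticAt_const h

theorem analyticAt_sqrt_one_sub {z : ℂ} (hz : 1 - z ∈ Complex.slitPlane) :
    AnalyticAt ℂ (fun z => Complex.sqrt (1 - z)) z :=
  analyticAt_sqrt_comp (analyticAt_const.sub analyticAt_id) hz

theorem tendsto_sqrt_one_sub : Tendsto (fun z : ℂ => Complex.sqrt (1 - z)) (𝓝 1) (𝓝 0) := by
  have hcont : ContinuousAt (fun z : ℂ => Complex.sqrt (1 - z)) 1 :=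
    ContinuousAt.comp (g := Complex.sqrt) (Complex.continuousAt_sqrt (by simp)) (by fun_prop)
  simpa only [ContinuousAt, sub_self, Complex.sqrt_zero] using hcont

theorem one_sub_mem_slitPlane {z : ℂ} (hz : ‖z‖ ≤ 1) (hz₁ : z ≠ 1) :
    1 - z ∈ Complex.slitPlane := by
  rw [Complex.mem_slitPlane_iff, Complex.sub_re, Complex.one_re, sub_pos, Complex.sub_im,
    Complex.one_im, zero_sub, neg_ne_zero]
  by_contra! hzre
  exact hz₁ (Complex.ext (le_antisymm ((Complex.re_le_norm z).trans hz) hzre.1) hzre.2)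

end Sqrt

section SingularityAnalysis

theorem coeff_eq_iteratedDeriv_div_factorial {e : ℕ → ℂ} {G : ℂ → ℂ}
    (hsum : ∀ᶠ z in 𝓝 (0 : ℂ), HasSum (fun n => e n * z ^ n) (G z)) (n : ℕ) :
    e n = iteratedDeriv n G 0 / n.factorial := by
  have hseries : HasFPowerSeriesAt G (FormalMultilinearSeries.ofScalars ℂ e) 0 := by
    rw [hasFPowerSeriesAt_iff]
    filter_upwards [hsum] with z hz
    rw [zero_add]
    refine hz.congr_fun fun n => ?_
    rw [FormalMultilinearSeries.coeff_ofScalars, smul_eq_mul, mul_comm]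
  have hunique :=
    hseries.eq_formalMultilinearSeries hseries.analyticAt.hasFPowerSeriesAt
  simpa only [FormalMultilinearSeries.coeff_ofScalars] using
    congrArg (fun p => FormalMultilinearSeries.coeff p n) hunique

theorem norm_iteratedDeriv_le_of_forall_mem_ball_norm_le {f : ℂ → ℂ} {C : ℝ}
    (hf : DifferentiableOn ℂ f (Metric.ball 0 1))
    (hC : ∀ z ∈ Metric.ball (0 : ℂ) 1, ‖f z‖ ≤ C) (n : ℕ) :
    ‖iteratedDeriv n f 0‖ ≤ n.factorial * C := by
  have hcauchy : ∀ᶠ r in 𝓝[<] (1 : ℝ), ‖iteratedDeriv n f 0‖ ≤ n.factorial * C / r ^ n := by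
    filter_upwards [Ioo_mem_nhdsLT (zero_lt_one (α := ℝ))] with r hr
    have hsub : Metric.closedBall (0 : ℂ) r ⊆ Metric.ball 0 1 :=
      Metric.closedBall_subset_ball hr.2
    exact Complex.norm_iteratedDeriv_le_of_forall_mem_sphere_norm_le n hr.1
      (hf.mono (Metric.closure_ball_subset_closedBall.trans hsub)).diffContOnCl
      fun z hz => hC z (hsub (Metric.sphere_subset_closedBall hz))
  have hlim : Tendsto (fun r : ℝ => n.factorial * C / r ^ n) (𝓝[<] 1) (𝓝 (n.factorial * C)) := by
    have hcont : ContinuousAt (fun r : ℝ => n.factorial * C / r ^ n) 1 :=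
      ContinuousAt.div (by fun_prop) (by fun_prop) (by simp)
    simpa [ContinuousAt] using hcont.mono_left nhdsWithin_le_nhds
  exact ge_of_tendsto hlim hcauchy

theorem norm_coeff_mul_descFactorial_le {e : ℕ → ℂ} {G : ℂ → ℂ} {C : ℝ} {k : ℕ}
    (hsum : ∀ᶠ z in 𝓝 (0 : ℂ), HasSum (fun n => e n * z ^ n) (G z))
    (hdiff : DifferentiableOn ℂ (iteratedDeriv k G) (Metric.ball 0 1))
    (hC : ∀ z ∈ Metric.ball (0 : ℂ) 1, ‖iteratedDeriv k G z‖ ≤ C) (n : ℕ) :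
    ‖e n‖ * n.descFactorial k ≤ C := by
  rcases lt_or_ge n k with hn | hn
  · rw [Nat.descFactorial_eq_zero_iff_lt.2 hn, Nat.cast_zero, mul_zero]
    exact (norm_nonneg _).trans (hC 0 (Metric.mem_ball_self one_pos))
  · have hderiv := norm_iteratedDeriv_le_of_forall_mem_ball_norm_le hdiff hC (n - k)
    simp only [iteratedDeriv_eq_iterate] at hderiv
    rw [← Function.iterate_add_apply, Nat.sub_add_cancel hn, ← iteratedDeriv_eq_iterate] at hderiv
    have hpos : (0 : ℝ) < (n - k).factorial := Nat.cast_pos.2 (Nat.factorial_pos _)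
    have hdesc : (n.descFactorial k : ℝ) ≠ 0 :=
      Nat.cast_ne_zero.2 fun h => (Nat.descFactorial_eq_zero_iff_lt.1 h).not_ge hn
    rw [coeff_eq_iteratedDeriv_div_factorial hsum, norm_div, Complex.norm_natCast,
      ← Nat.factorial_mul_descFactorial hn, Nat.cast_mul, div_mul_eq_mul_div,
      mul_div_mul_right _ _ hdesc, div_le_iff₀ hpos, mul_comm]
    exact hderiv

theorem natCast_pow_le_two_pow_mul_descFactorial {n k : ℕ} (h : 2 * k ≤ n) :
    (n : ℝ) ^ k ≤ 2 ^ k * n.descFactorial k := by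
  have hpow : n ^ k ≤ 2 ^ k * n.descFactorial k :=
    calc n ^ k ≤ (2 * (n + 1 - k)) ^ k := Nat.pow_le_pow_left (by lia) k
      _ = 2 ^ k * (n + 1 - k) ^ k := mul_pow _ _ _
      _ ≤ 2 ^ k * n.descFactorial k := Nat.mul_le_mul_left _ (Nat.pow_sub_le_descFactorial n k)
  exact_mod_cast hpow

theorem tendsto_mul_rpow_of_norm_mul_descFactorial_le {e : ℕ → ℂ} {C b : ℝ} {k : ℕ}
    (hb : b < k) (he : ∀ n : ℕ, ‖e n‖ * n.descFactorial k ≤ C) :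
    Tendsto (fun n : ℕ => e n * (((n : ℝ) ^ b : ℝ) : ℂ)) atTop (𝓝 0) := by
  have hdecay : Tendsto (fun n : ℕ => 2 ^ k * C * (n : ℝ) ^ (-(k - b))) atTop (𝓝 0) := by
    rw [← mul_zero (2 ^ k * C)]
    exact ((tendsto_rpow_neg_atTop (sub_pos.2 hb)).comp tendsto_natCast_atTop_atTop).const_mul _
  refine squeeze_zero_norm' ?_ hdecay
  filter_upwards [eventually_ge_atTop (2 * k), eventually_gt_atTop 0] with n hn hn0
  have hpos : (0 : ℝ) < n := Nat.cast_pos.2 hn0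
  calc ‖e n * (((n : ℝ) ^ b : ℝ) : ℂ)‖ = ‖e n‖ * (n : ℝ) ^ k * (n : ℝ) ^ (-(k - b)) := by
        rw [norm_mul, Complex.norm_real, Real.norm_of_nonneg (by positivity), mul_assoc,
          ← Real.rpow_natCast, ← Real.rpow_add hpos, neg_sub, add_sub_cancel]
    _ ≤ ‖e n‖ * (2 ^ k * n.descFactorial k) * (n : ℝ) ^ (-(k - b)) := by
        gcongr
        exact natCast_pow_le_two_pow_mul_descFactorial hn
    _ = 2 ^ k * (‖e n‖ * n.descFactorial k) * (n : ℝ) ^ (-(k - b)) := by ring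
    _ ≤ 2 ^ k * C * (n : ℝ) ^ (-(k - b)) := by
        gcongr
        exact he n

theorem hasDerivAt_add_sqrt_sq_mul {m : ℂ → ℂ} {z : ℂ} (C : ℂ) (hz : 1 - z ∈ Complex.slitPlane)
    (hm : DifferentiableAt ℂ m (Complex.sqrt (1 - z))) :
    HasDerivAt (fun z => C + Complex.sqrt (1 - z) ^ 2 * m (Complex.sqrt (1 - z)))
      (-(m (Complex.sqrt (1 - z)) +
        Complex.sqrt (1 - z) / 2 * deriv m (Complex.sqrt (1 - z)))) z := by
  have hsqrt := hasDerivAt_sqrt_one_sub hz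
  have hne := sqrt_ne_zero (Complex.slitPlane_ne_zero hz)
  refine (((hsqrt.pow 2).mul (hm.hasDerivAt.comp z hsqrt)).const_add C).congr_deriv ?_
  simp only [Function.comp_apply, Pi.pow_apply]
  field_simp
  ring

theorem eventually_deriv_eq_of_eq_add_sqrt_sq_mul {G m : ℂ → ℂ} {C : ℂ} (hm : AnalyticAt ℂ m 0)
    (hG : ∀ᶠ z in 𝓝 (1 : ℂ), ‖z‖ < 1 →
      G z = C + Complex.sqrt (1 - z) ^ 2 * m (Complex.sqrt (1 - z))) :
    ∀ᶠ z in 𝓝 (1 : ℂ), ‖z‖ < 1 → deriv G z = -(m (Complex.sqrt (1 - z)) +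
      Complex.sqrt (1 - z) / 2 * deriv m (Complex.sqrt (1 - z))) := by
  filter_upwards [hG.eventually_nhds, tendsto_sqrt_one_sub.eventually hm.eventually_analyticAt]
    with z hGz hmz hz
  have heq : G =ᶠ[𝓝 z] fun z => C + Complex.sqrt (1 - z) ^ 2 * m (Complex.sqrt (1 - z)) := by
    filter_upwards [hGz, continuous_norm.continuousAt.eventually (gt_mem_nhds hz)] with w hw hw1
      using hw hw1
  have hslit := one_sub_mem_slitPlane hz.le (by rintro rfl; simp at hz)
  rw [heq.deriv_eq, (hasDerivAt_add_sqrt_sq_mul C hslit hmz.differentiableAt).deriv]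

theorem eventually_deriv_eq_of_eq_add_sqrt_pow_four_mul {G g : ℂ → ℂ} {t₀ t₂ : ℂ}
    (hg : AnalyticAt ℂ g 0)
    (hG : ∀ᶠ z in 𝓝 (1 : ℂ), ‖z‖ < 1 → G z = t₀ + Complex.sqrt (1 - z) ^ 2 *
      (t₂ + Complex.sqrt (1 - z) ^ 2 * g (Complex.sqrt (1 - z)))) :
    ∀ᶠ z in 𝓝 (1 : ℂ), ‖z‖ < 1 → deriv G z = -t₂ + Complex.sqrt (1 - z) ^ 2 *
      -(2 * g (Complex.sqrt (1 - z)) +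
        Complex.sqrt (1 - z) / 2 * deriv g (Complex.sqrt (1 - z))) := by
  have hm : AnalyticAt ℂ (fun s => t₂ + s ^ 2 * g s) 0 := by fun_prop
  filter_upwards [eventually_deriv_eq_of_eq_add_sqrt_sq_mul hm hG,
    tendsto_sqrt_one_sub.eventually hg.eventually_analyticAt] with z hderiv hgz hz
  rw [hderiv hz]
  generalize Complex.sqrt (1 - z) = s at *
  have hderiv_m : deriv (fun s => t₂ + s ^ 2 * g s) s = 2 * s * g s + s ^ 2 * deriv g s := by
    refine (((((hasDerivAt_id s).pow 2).mul
      hgz.differentiableAt.hasDerivAt).const_add t₂).congr_deriv ?_).deriv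
    simp
  rw [hderiv_m]
  ring

theorem exists_norm_deriv_deriv_le_of_eq_add_sqrt_pow_four_mul {G g : ℂ → ℂ} {t₀ t₂ : ℂ}
    (hg : AnalyticAt ℂ g 0)
    (hG : ∀ᶠ z in 𝓝 (1 : ℂ), ‖z‖ < 1 → G z = t₀ + Complex.sqrt (1 - z) ^ 2 *
      (t₂ + Complex.sqrt (1 - z) ^ 2 * g (Complex.sqrt (1 - z)))) :
    ∃ C : ℝ, ∀ᶠ z in 𝓝 (1 : ℂ), ‖z‖ < 1 → ‖deriv (deriv G) z‖ ≤ C := by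
  set p : ℂ → ℂ := fun s => -(2 * g s + s / 2 * deriv g s)
  have hp : AnalyticAt ℂ p 0 :=
    ((analyticAt_const.mul hg).add (analyticAt_id.div_const.mul hg.deriv)).neg
  have hderiv := eventually_deriv_eq_of_eq_add_sqrt_sq_mul hp
    (eventually_deriv_eq_of_eq_add_sqrt_pow_four_mul hg hG)
  have hbound : ContinuousAt (fun s => ‖-(p s + s / 2 * deriv p s)‖) 0 :=
    (hp.add (analyticAt_id.div_const.mul hp.deriv)).neg.continuousAt.norm
  refine ⟨‖-(p 0 + 0 / 2 * deriv p 0)‖ + 1, ?_⟩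
  filter_upwards [hderiv,
    tendsto_sqrt_one_sub.eventually (hbound.eventually (gt_mem_nhds (lt_add_one _)))]
    with z hz hle hz1
  rw [hz hz1]
  exact hle.le

theorem exists_forall_norm_le_of_forall_eventually_norm_le {h : ℂ → ℂ}
    (hloc : ∀ z : ℂ, ‖z‖ ≤ 1 → ∃ C : ℝ, ∀ᶠ w in 𝓝 z, ‖w‖ < 1 → ‖h w‖ ≤ C) :
    ∃ C : ℝ, ∀ z, ‖z‖ < 1 → ‖h z‖ ≤ C := by
  obtain ⟨C, hC⟩ := (isCompact_closedBall (0 : ℂ) 1).induction_on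
    (p := fun s => ∃ C : ℝ, ∀ z ∈ s, ‖z‖ < 1 → ‖h z‖ ≤ C) ⟨0, by simp⟩
    (fun s t hst ⟨C, hC⟩ => ⟨C, fun z hz => hC z (hst hz)⟩)
    (fun s t ⟨C, hC⟩ ⟨D, hD⟩ => ⟨max C D, fun z hz hz1 => hz.elim
      (fun hz => (hC z hz hz1).trans (le_max_left _ _))
      (fun hz => (hD z hz hz1).trans (le_max_right _ _))⟩)
    (fun z hz => by
      obtain ⟨C, hC⟩ := hloc z (mem_closedBall_zero_iff.1 hz)
      exact ⟨_, mem_nhdsWithin_of_mem_nhds hC, C, fun w hw => hw⟩)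
  exact ⟨C, fun z hz => hC z (mem_closedBall_zero_iff.2 hz.le) hz⟩

theorem tendsto_coeff_of_eq_add_sqrt_pow_four_mul {e : ℕ → ℂ} {G g : ℂ → ℂ} {t₀ t₂ : ℂ} {b : ℝ}
    (hb : b < 2) (hG : ∀ z, ‖z‖ ≤ 1 → z ≠ 1 → AnalyticAt ℂ G z)
    (hsum : ∀ z, ‖z‖ < 1 → HasSum (fun n => e n * z ^ n) (G z)) (hg : AnalyticAt ℂ g 0)
    (hnear : ∀ᶠ z in 𝓝 (1 : ℂ), ‖z‖ < 1 → G z = t₀ + Complex.sqrt (1 - z) ^ 2 *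
      (t₂ + Complex.sqrt (1 - z) ^ 2 * g (Complex.sqrt (1 - z)))) :
    Tendsto (fun n : ℕ => e n * (((n : ℝ) ^ b : ℝ) : ℂ)) atTop (𝓝 0) := by
  have hderiv₂ : iteratedDeriv 2 G = deriv (deriv G) := by
    rw [iteratedDeriv_succ, iteratedDeriv_one]
  obtain ⟨C, hC⟩ : ∃ C : ℝ, ∀ z, ‖z‖ < 1 → ‖deriv (deriv G) z‖ ≤ C := by
    refine exists_forall_norm_le_of_forall_eventually_norm_le fun z hz => ?_
    rcases eq_or_ne z 1 with rfl | hz1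
    · exact exists_norm_deriv_deriv_le_of_eq_add_sqrt_pow_four_mul hg hnear
    · have hcont := (hG z hz hz1).deriv.deriv.continuousAt.norm
      exact ⟨_, (hcont.eventually (gt_mem_nhds (lt_add_one _))).mono fun w hw _ => hw.le⟩
  refine tendsto_mul_rpow_of_norm_mul_descFactorial_le (k := 2) (by exact_mod_cast hb)
    (norm_coeff_mul_descFactorial_le (G := G) (C := C) ?_ ?_ ?_)
  · filter_upwards [Metric.ball_mem_nhds (0 : ℂ) one_pos] with z hz
      using hsum z (mem_ball_zero_iff.1 hz)
  · intro z hz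
    rw [mem_ball_zero_iff] at hz
    rw [hderiv₂]
    exact (hG z hz.le (by rintro rfl; simp at hz)).deriv.deriv.differentiableWithinAt
  · intro z hz
    rw [hderiv₂]
    exact hC z (mem_ball_zero_iff.1 hz)

theorem tendsto_sqrt_coeff_mul_rpow :
    Tendsto (fun n : ℕ => (binomCoeff ((1 : ℕ) / 2) n : ℂ) * (((n : ℝ) ^ (3 / 2 : ℝ) : ℝ) : ℂ))
      atTop (𝓝 ((-1 / (2 * √Real.pi) : ℝ) : ℂ)) := by
  have hlim := tendsto_binomCoeff_mul_rpow (natCast_div_two_ne_natCast odd_one)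
  rw [Nat.cast_one, gamma_neg_half, inv_neg, ← one_div, ← neg_div,
    show (1 / 2 + 1 : ℝ) = 3 / 2 by norm_num] at hlim
  simpa only [Function.comp_def, Complex.ofReal_mul, Nat.cast_one] using
    (Complex.continuous_ofReal.tendsto _).comp hlim

theorem tendsto_sqrt_cube_coeff_mul_rpow :
    Tendsto (fun n : ℕ => (binomCoeff ((3 : ℕ) / 2) n : ℂ) * (((n : ℝ) ^ (3 / 2 : ℝ) : ℝ) : ℂ))
      atTop (𝓝 0) := by
  have hlim := tendsto_binomCoeff_mul_rpow_of_lt (b := 3 / 2)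
    (natCast_div_two_ne_natCast (k := 3) (by decide)) (by norm_num)
  simpa only [Function.comp_def, Complex.ofReal_mul, Complex.ofReal_zero] using
    (Complex.continuous_ofReal.tendsto _).comp hlim

/-- Subtracting the odd terms of orders `1` and `3` in `√(1 - z)` leaves a function with bounded
second derivative, whose coefficients are `O(n⁻²)`. -/
theorem tendsto_coeff_of_sqrt_singularity {c : ℕ → ℂ} {F T : ℂ → ℂ}
    (hF : ∀ z, ‖z‖ ≤ 1 → z ≠ 1 → AnalyticAt ℂ F z)
    (hsum : ∀ z, ‖z‖ < 1 → HasSum (fun n => c n * z ^ n) (F z))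
    (hT : AnalyticAt ℂ T 0)
    (hFT : ∀ᶠ z in 𝓝 (1 : ℂ), ‖z‖ < 1 → F z = T (Complex.sqrt (1 - z))) :
    Tendsto (fun n : ℕ => c n * (((n : ℝ) ^ (3 / 2 : ℝ) : ℝ) : ℂ)) atTop
      (𝓝 (deriv T 0 * ((-1 / (2 * √Real.pi) : ℝ) : ℂ))) := by
  obtain ⟨g, hg, hTaylor⟩ := hT.exists_eq_sum_add_pow_mul 4
  simp only [Finset.sum_range_succ, Finset.sum_range_zero, iteratedDeriv_one, smul_eq_mul]
    at hTaylor
  set t₃ := iteratedDeriv 3 T 0 / Nat.factorial 3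
  have hremainder := tendsto_coeff_of_eq_add_sqrt_pow_four_mul (b := 3 / 2)
    (G := fun z => F z - deriv T 0 * Complex.sqrt (1 - z) ^ 1 - t₃ * Complex.sqrt (1 - z) ^ 3)
    (e := fun n => c n - deriv T 0 * binomCoeff ((1 : ℕ) / 2) n - t₃ * binomCoeff ((3 : ℕ) / 2) n)
    (t₀ := T 0) (t₂ := iteratedDeriv 2 T 0 / 2) (by norm_num)
    (fun z hz hz1 => by
      have hsqrt := analyticAt_sqrt_one_sub (one_sub_mem_slitPlane hz hz1)
      have := hF z hz hz1
      fun_prop)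
    (fun z hz => by
      simp only [sqrt_pow_eq_cpow]
      refine (((hsum z hz).sub ((hasSum_binomCoeff _ hz).mul_left _)).sub
        ((hasSum_binomCoeff _ hz).mul_left _)).congr_fun fun n => ?_
      ring) hg
    (by
      filter_upwards [hFT] with z hz hz1
      rw [hz hz1, hTaylor]
      simp only [t₃, Nat.factorial, iteratedDeriv_zero]
      push_cast
      ring)
  have hlim := (hremainder.add (tendsto_sqrt_coeff_mul_rpow.const_mul (deriv T 0))).add
    (tendsto_sqrt_cube_coeff_mul_rpow.const_mul t₃)
  rw [zero_add, mul_zero, add_zero] at hlim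
  exact hlim.congr fun n => by ring

end SingularityAnalysis

section LocalInversion

theorem exists_analyticAt_leftInverse {K : ℂ → ℂ} {a : ℂ} (hK : AnalyticAt ℂ K a)
    (hK' : deriv K a ≠ 0) :
    ∃ L : ℂ → ℂ, AnalyticAt ℂ L (K a) ∧ deriv L (K a) = (deriv K a)⁻¹ ∧
      ∀ᶠ u in 𝓝 a, L (K u) = u :=
  ⟨hK.hasStrictDerivAt.localInverse _ _ _ hK', hK.analyticAt_localInverse hK',
    (HasStrictDerivAt.to_localInverse hK.hasStrictDerivAt hK').hasDerivAt.deriv,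
    HasStrictDerivAt.eventually_left_inverse hK.hasStrictDerivAt hK'⟩

theorem deriv_id_div_ne_zero {Φ : ℂ → ℂ} {a : ℂ} (hΦ : DifferentiableAt ℂ Φ a) (h0 : Φ a ≠ 0)
    (hcrit : Φ a ≠ a * deriv Φ a) : deriv (fun u => u / Φ u) a ≠ 0 := by
  have hderiv := ((hasDerivAt_id a).fun_div hΦ.hasDerivAt h0).deriv
  simp only [id] at hderiv
  rw [hderiv, one_mul]
  exact div_ne_zero (sub_ne_zero.2 hcrit) (pow_ne_zero 2 h0)

theorem exists_analyticAt_of_noncritical {Φ v : ℂ → ℂ} {c : ℂ} (hΦ : AnalyticAt ℂ Φ (v c))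
    (h0 : Φ (v c) ≠ 0) (hcrit : Φ (v c) ≠ v c * deriv Φ (v c)) (hc : ‖c‖ ≤ 1)
    (hcont : ContinuousWithinAt v (Metric.closedBall 0 1) c)
    (hv : ∀ z, ‖z‖ ≤ 1 → v z = z * Φ (v z)) :
    ∃ E : ℂ → ℂ, AnalyticAt ℂ E c ∧ E c = v c ∧ ∀ᶠ z in 𝓝 c, ‖z‖ ≤ 1 → E z = v z := by
  have hsolve : ∀ {z}, ‖z‖ ≤ 1 → Φ (v z) ≠ 0 → v z / Φ (v z) = z := fun hz hz0 =>
    (div_eq_iff hz0).2 (hv _ hz)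
  obtain ⟨E, hE, -, hinv⟩ := exists_analyticAt_leftInverse (K := fun u => u / Φ u)
    (analyticAt_id.div hΦ h0) (deriv_id_div_ne_zero hΦ.differentiableAt h0 hcrit)
  simp only [hsolve hc h0] at hE
  refine ⟨E, hE, by simpa only [hsolve hc h0] using hinv.self_of_nhds, ?_⟩
  have hnear := hcont.eventually (hinv.and (hΦ.continuousAt.eventually_ne h0))
  rw [eventually_nhdsWithin_iff] at hnear
  filter_upwards [hnear] with z hz hz1
  obtain ⟨hleft, hne⟩ := hz (mem_closedBall_zero_iff.2 hz1)
  rwa [hsolve hz1 hne] at hleft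

theorem re_sqrt_nonneg (z : ℂ) : 0 ≤ (Complex.sqrt z).re := by
  rw [Complex.sqrt, Complex.cpow_inv_two_re]
  exact Real.sqrt_nonneg _

theorem re_sq_sub_im_sq_sqrt (z : ℂ) :
    (Complex.sqrt z).re ^ 2 - (Complex.sqrt z).im ^ 2 = z.re := by
  conv_rhs => rw [← sqrt_sq z, pow_two, Complex.mul_re]
  ring

theorem abs_im_sqrt_le {z : ℂ} (hz : 0 ≤ z.re) :
    |(Complex.sqrt z).im| ≤ (Complex.sqrt z).re := by
  refine abs_le_of_sq_le_sq ?_ (re_sqrt_nonneg z)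
  linarith [re_sq_sub_im_sq_sqrt z]

theorem eq_zero_of_re_nonpos_of_mul_mem_cone {h q : ℂ} (hh : h.re ≤ 0) (hq : |q.im| < q.re)
    (hhq : |(h * q).im| ≤ (h * q).re) : h * q = 0 := by
  have hconj : (h * q).re * q.re + (h * q).im * q.im = h.re * Complex.normSq q := by
    rw [Complex.mul_re, Complex.mul_im, Complex.normSq_apply]
    ring
  have hnonpos : h.re * Complex.normSq q ≤ 0 :=
    mul_nonpos_of_nonpos_of_nonneg hh (Complex.normSq_nonneg _)
  have him : -((h * q).re * |q.im|) ≤ (h * q).im * q.im := by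
    refine le_trans (neg_le_neg ?_) (neg_abs_le _)
    rw [abs_mul]
    exact mul_le_mul_of_nonneg_right hhq (abs_nonneg _)
  have hre : (h * q).re = 0 := by
    have hre_nonneg := (abs_nonneg _).trans hhq
    nlinarith
  rw [hre] at hhq
  exact Complex.ext hre (abs_nonpos_iff.1 hhq)

theorem neg_mul_eq_sqrt {h q z : ℂ} (hz : 0 ≤ z.re) (hh : h.re ≤ 0) (hq : |q.im| < q.re)
    (hsq : (h * q) ^ 2 = z) : -(h * q) = Complex.sqrt z := by
  rcases sq_eq_sq_iff_eq_or_eq_neg.1 (hsq.trans (sqrt_sq z).symm) with heq | heq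
  · have hzero := eq_zero_of_re_nonpos_of_mul_mem_cone hh hq (heq ▸ abs_im_sqrt_le hz)
    rw [← heq, hzero, neg_zero]
  · rw [heq, neg_neg]

theorem exists_one_sub_div_eq_sq_mul {Φ : ℂ → ℂ} (hΦ : AnalyticAt ℂ Φ 1) (h0 : Φ 1 = 1)
    (h1 : deriv Φ 1 = 1) :
    ∃ H : ℂ → ℂ, AnalyticAt ℂ H 1 ∧ H 1 = deriv (deriv Φ) 1 / 2 ∧
      ∀ u, Φ u ≠ 0 → 1 - u / Φ u = (u - 1) ^ 2 * H u := by
  have hshift : AnalyticAt ℂ (fun h => Φ (1 + h)) 0 :=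
    hΦ.comp_of_eq (analyticAt_const.add analyticAt_id) (add_zero 1)
  obtain ⟨g, hg, hTaylor⟩ := hshift.exists_eq_sum_add_pow_mul 3
  simp only [Finset.sum_range_succ, Finset.sum_range_zero, iteratedDeriv_comp_const_add,
    iteratedDeriv_zero, iteratedDeriv_succ, add_zero, h0, h1, smul_eq_mul] at hTaylor
  have hg1 : AnalyticAt ℂ (fun u => g (u - 1)) 1 :=
    hg.comp_of_eq (analyticAt_id.sub analyticAt_const) (sub_self 1)
  refine ⟨fun u => (deriv (deriv Φ) 1 / 2 + (u - 1) * g (u - 1)) / Φ u,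
    (analyticAt_const.add ((analyticAt_id.sub analyticAt_const).mul hg1)).div hΦ
      (by rw [h0]; exact one_ne_zero), by simp only [sub_self, zero_mul, add_zero, h0, div_one],
    fun u hu => ?_⟩
  have hΦu := hTaylor (u - 1)
  rw [add_sub_cancel] at hΦu
  rw [one_sub_div hu, mul_div_assoc', div_left_inj' hu, hΦu]
  simp only [Nat.factorial]
  push_cast
  ring

theorem deriv_neg_sub_mul {q : ℂ → ℂ} {a : ℂ} (hq : DifferentiableAt ℂ q a) :
    deriv (fun u => -((u - a) * q u)) a = -q a := by
  have hderiv := (((hasDerivAt_id a).sub_const a).fun_mul hq.hasDerivAt).fun_neg.deriv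
  simpa only [id, sub_self, zero_mul, add_zero, one_mul] using hderiv

theorem eventually_abs_im_lt_re {q : ℂ → ℂ} {a : ℂ} (hq : ContinuousAt q a)
    (hpos : |(q a).im| < (q a).re) : ∀ᶠ u in 𝓝 a, |(q u).im| < (q u).re :=
  (Complex.continuous_im.continuousAt.comp hq).abs.eventually_lt
    (Complex.continuous_re.continuousAt.comp hq) hpos

/-- Writing `v = 1 + h`, the equation reads `1 - z = h ^ 2 H(v)` with `H 1 = κ / 2`; since
`Re h ≤ 0`, the right choice of square root is `√(1 - z) = -h √(H v)`, which can be inverted. -/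
theorem exists_sqrt_expansion_of_critical {Φ v : ℂ → ℂ} {κ : ℝ} (hΦ : AnalyticAt ℂ Φ 1)
    (h0 : Φ 1 = 1) (h1 : deriv Φ 1 = 1) (h2 : deriv (deriv Φ) 1 = κ) (hκ : 0 < κ)
    (hv1 : v 1 = 1) (hcont : ContinuousWithinAt v (Metric.closedBall 0 1) 1)
    (hle : ∀ z, ‖z‖ ≤ 1 → ‖v z‖ ≤ 1) (hv : ∀ z, ‖z‖ ≤ 1 → v z = z * Φ (v z)) :
    ∃ χ : ℂ → ℂ, AnalyticAt ℂ χ 0 ∧ χ 0 = 1 ∧ deriv χ 0 = -((√(2 / κ) : ℝ) : ℂ) ∧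
      ∀ᶠ z in 𝓝 (1 : ℂ), ‖z‖ ≤ 1 → v z = χ (Complex.sqrt (1 - z)) := by
  obtain ⟨H, hH, hH1, hHeq⟩ := exists_one_sub_div_eq_sq_mul hΦ h0 h1
  have hH1 : H 1 = ((κ / 2 : ℝ) : ℂ) := by rw [hH1, h2, Complex.ofReal_div, Complex.ofReal_ofNat]
  set q : ℂ → ℂ := fun u => Complex.sqrt (H u) with hq
  have hqan : AnalyticAt ℂ q 1 := analyticAt_sqrt_comp hH (by
    rw [hH1, Complex.ofReal_mem_slitPlane]
    positivity)
  have hq1 : q 1 = ((√(κ / 2) : ℝ) : ℂ) := by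
    simp only [hq]
    rw [hH1, Complex.sqrt_of_nonneg (Complex.zero_le_real.2 (by positivity)), Complex.ofReal_re]
  have hsqrt_pos : 0 < √(κ / 2) := Real.sqrt_pos.2 (by positivity)
  set K : ℂ → ℂ := fun u => -((u - 1) * q u) with hK
  have hK1 : K 1 = 0 := by simp only [hK, sub_self, zero_mul, neg_zero]
  have hK' : deriv K 1 = -((√(κ / 2) : ℝ) : ℂ) := by
    rw [hK, deriv_neg_sub_mul hqan.differentiableAt, hq1]
  obtain ⟨χ, hχ, hχ', hinv⟩ := exists_analyticAt_leftInverse (K := K) (a := 1)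
    ((analyticAt_id.sub analyticAt_const).mul hqan).neg
    (hK' ▸ neg_ne_zero.2 (Complex.ofReal_ne_zero.2 hsqrt_pos.ne'))
  rw [hK1] at hχ hχ'
  refine ⟨χ, hχ, by simpa only [hK1] using hinv.self_of_nhds,
    by rw [hχ', hK', inv_neg, ← Complex.ofReal_inv, ← Real.sqrt_inv, inv_div], ?_⟩
  have hcone := eventually_abs_im_lt_re hqan.continuousAt (by simpa [hq1] using hsqrt_pos)
  have hne := hΦ.continuousAt.eventually_ne (y := 0) (by rw [h0]; exact one_ne_zero)
  have hnear := (hv1 ▸ hcont.tendsto).eventually (hinv.and (hcone.and hne))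
  rw [eventually_nhdsWithin_iff] at hnear
  filter_upwards [hnear] with z hz hz1
  obtain ⟨hleft, hqv, hΦv⟩ := hz (mem_closedBall_zero_iff.2 hz1)
  have hsq : ((v z - 1) * q (v z)) ^ 2 = 1 - z := by
    rw [mul_pow, sqrt_sq, ← hHeq _ hΦv, (div_eq_iff hΦv).2 (hv z hz1)]
  have hroot : K (v z) = Complex.sqrt (1 - z) := neg_mul_eq_sqrt
    (by simpa using (Complex.re_le_norm z).trans hz1)
    (by simpa using (Complex.re_le_norm (v z)).trans (hle z hz1)) hqv hsq
  rw [← hroot, hleft]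

end LocalInversion

section Continuation

/-- `E` continues `f` analytically from the open unit disc to `B(c, r) ∩ Ω`, where `c` lies on the
unit circle. -/
structure IsLocalContinuation (Ω : Set ℂ) (f : ℂ → ℂ) (c : ℂ) (r : ℝ) (E : ℂ → ℂ) : Prop where
  norm_eq : ‖c‖ = 1
  pos : 0 < r
  analyticAt : ∀ z ∈ Metric.ball c r, z ∈ Ω → AnalyticAt ℂ E z
  eq : ∀ z ∈ Metric.ball c r, ‖z‖ < 1 → E z = f z

theorem norm_inv_norm_smul_sub_le {V : Type*} [NormedAddCommGroup V] [InnerProductSpace ℝ V]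
    {z c : V} (hz : 1 ≤ ‖z‖) (hc : ‖c‖ = 1) : ‖‖z‖⁻¹ • z - c‖ ≤ ‖z - c‖ := by
  have hz0 : 0 < ‖z‖ := one_pos.trans_le hz
  have hunit : ‖‖z‖⁻¹ • z‖ = 1 := norm_smul_inv_norm (𝕜 := ℝ) (norm_pos_iff.1 hz0)
  set y := inner ℝ (‖z‖⁻¹ • z) c with hy
  have hy1 : y ≤ 1 := by simpa only [hunit, hc, mul_one] using real_inner_le_norm (‖z‖⁻¹ • z) c
  have hinner : inner ℝ z c = ‖z‖ * y := by
    rw [hy, real_inner_smul_left, mul_inv_cancel_left₀ hz0.ne']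
  refine le_of_sq_le_sq ?_ (norm_nonneg _)
  rw [norm_sub_sq_real, norm_sub_sq_real, hunit, hc, hinner]
  nlinarith [mul_nonneg (sub_nonneg.2 hz) (sub_nonneg.2 hy1)]

theorem inv_norm_smul_mem_ball {V : Type*} [NormedAddCommGroup V] [InnerProductSpace ℝ V]
    {z c : V} {r : ℝ} (hz : 1 ≤ ‖z‖) (hc : ‖c‖ = 1) (hzc : z ∈ Metric.ball c r) :
    ‖z‖⁻¹ • z ∈ Metric.ball c r :=
  mem_ball_iff_norm.2 ((norm_inv_norm_smul_sub_le hz hc).trans_lt (mem_ball_iff_norm.1 hzc))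

theorem exists_smul_mem_of_inv_norm_smul_mem {V : Type*} [NormedAddCommGroup V] [NormedSpace ℝ V]
    {U : Set V} (hU : IsOpen U) {z : V} (hz : z ≠ 0) (hzU : ‖z‖⁻¹ • z ∈ U) :
    ∃ t : ℝ, 0 < t ∧ t < ‖z‖⁻¹ ∧ t • z ∈ U := by
  have hcont : ContinuousAt (fun t : ℝ => t • z) ‖z‖⁻¹ := by fun_prop
  have hnear : ∀ᶠ t in 𝓝[<] ‖z‖⁻¹, t • z ∈ U ∧ 0 < t :=
    ((hcont.eventually (hU.mem_nhds hzU)).and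
      (lt_mem_nhds (inv_pos.2 (norm_pos_iff.2 hz)))).filter_mono nhdsWithin_le_nhds
  obtain ⟨t, ⟨htU, ht0⟩, htlt⟩ := (hnear.and self_mem_nhdsWithin).exists
  exact ⟨t, ht0, htlt, htU⟩

theorem segment_smul_subset_of_starConvex {V : Type*} [AddCommGroup V] [Module ℝ V] {Ω : Set V}
    (hΩ : StarConvex ℝ 0 Ω) {z : V} (hz : z ∈ Ω) {t : ℝ} (ht0 : 0 ≤ t) (ht1 : t ≤ 1) :
    segment ℝ (t • z) z ⊆ Ω := by
  refine ((convex_segment (𝕜 := ℝ) 0 z).segment_subset ?_ (right_mem_segment ℝ 0 z)).trans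
    (hΩ.segment_subset hz)
  exact ⟨1 - t, t, sub_nonneg.2 ht1, ht0, sub_add_cancel 1 t, by rw [smul_zero, zero_add]⟩

theorem IsLocalContinuation.eq_of_mem {Ω : Set ℂ} (hstar : StarConvex ℝ 0 Ω) {f : ℂ → ℂ}
    {c c' : ℂ} {r r' : ℝ} {E E' : ℂ → ℂ} (h : IsLocalContinuation Ω f c r E)
    (h' : IsLocalContinuation Ω f c' r' E') {z : ℂ} (hz : z ∈ Metric.ball c r)
    (hz' : z ∈ Metric.ball c' r') (hzΩ : z ∈ Ω) : E z = E' z := by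
  rcases lt_or_ge ‖z‖ 1 with hlt | hge
  · rw [h.eq z hz hlt, h'.eq z hz' hlt]
  have hz0 : 0 < ‖z‖ := one_pos.trans_le hge
  set U := Metric.ball c r ∩ Metric.ball c' r'
  have hU : IsOpen U := Metric.isOpen_ball.inter Metric.isOpen_ball
  obtain ⟨t, ht0, htlt, htU⟩ := exists_smul_mem_of_inv_norm_smul_mem hU (norm_pos_iff.1 hz0)
    ⟨inv_norm_smul_mem_ball hge h.norm_eq hz, inv_norm_smul_mem_ball hge h'.norm_eq hz'⟩
  have htz : ‖t • z‖ < 1 := by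
    rwa [norm_smul, Real.norm_of_nonneg ht0.le, ← lt_div_iff₀ hz0, one_div]
  have hsegU : segment ℝ (t • z) z ⊆ U :=
    ((convex_ball c r).inter (convex_ball c' r')).segment_subset htU ⟨hz, hz'⟩
  have hsegΩ : segment ℝ (t • z) z ⊆ Ω := segment_smul_subset_of_starConvex hstar hzΩ ht0.le
    (htlt.le.trans (inv_le_one_of_one_le₀ hge))
  have heq : E =ᶠ[𝓝 (t • z)] E' := by
    filter_upwards [hU.mem_nhds htU, continuous_norm.continuousAt.eventually (gt_mem_nhds htz)]
      with w hw hw1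
    rw [h.eq w hw.1 hw1, h'.eq w hw.2 hw1]
  have hE : AnalyticOnNhd ℂ E (segment ℝ (t • z) z) := fun w hw =>
    h.analyticAt w (hsegU hw).1 (hsegΩ hw)
  have hE' : AnalyticOnNhd ℂ E' (segment ℝ (t • z) z) := fun w hw =>
    h'.analyticAt w (hsegU hw).2 (hsegΩ hw)
  exact hE.eqOn_of_preconnected_of_eventuallyEq hE' (convex_segment _ _).isPreconnected
    (left_mem_segment ℝ _ _) heq (right_mem_segment ℝ _ _)

theorem IsLocalContinuation.of_eventually {Ω : Set ℂ} {f E : ℂ → ℂ} {c : ℂ} (hc : ‖c‖ = 1)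
    (hE : ∀ᶠ z in 𝓝 c, z ∈ Ω → AnalyticAt ℂ E z) (heq : ∀ᶠ z in 𝓝 c, ‖z‖ < 1 → E z = f z) :
    ∃ r, IsLocalContinuation Ω f c r E := by
  obtain ⟨r, hr, hball⟩ := Metric.eventually_nhds_iff_ball.1 (hE.and heq)
  exact ⟨r, hc, hr, fun z hz => (hball z hz).1, fun z hz => (hball z hz).2⟩

theorem exists_pos_annulus_subset_iUnion_ball {V : Type*} [NormedAddCommGroup V] [NormedSpace ℝ V]
    [ProperSpace V] {r : Metric.sphere (0 : V) 1 → ℝ} (hr : ∀ c, 0 < r c) :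
    ∃ δ > 0, ∀ z : V, 1 ≤ ‖z‖ → ‖z‖ < 1 + δ →
      ∃ c : Metric.sphere (0 : V) 1, z ∈ Metric.ball (c : V) (r c) := by
  obtain ⟨δ, hδ, hcover⟩ := lebesgue_number_lemma_of_metric (isCompact_sphere (0 : V) 1)
    (c := fun c : Metric.sphere (0 : V) 1 => Metric.ball (c : V) (r c))
    (fun c => Metric.isOpen_ball)
    (fun c hc => Set.mem_iUnion.2 ⟨⟨c, hc⟩, Metric.mem_ball_self (hr ⟨c, hc⟩)⟩)
  refine ⟨δ, hδ, fun z hz hzδ => ?_⟩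
  have hz0 : 0 < ‖z‖ := one_pos.trans_le hz
  obtain ⟨c, hc⟩ := hcover (‖z‖⁻¹ • z)
    (mem_sphere_zero_iff_norm.2 (norm_smul_inv_norm (𝕜 := ℝ) (norm_pos_iff.1 hz0)))
  refine ⟨c, hc (mem_ball_iff_norm.2 ?_)⟩
  calc ‖z - ‖z‖⁻¹ • z‖ = ‖(1 - ‖z‖⁻¹) • z‖ := by rw [sub_smul, one_smul]
    _ = ‖z‖ - 1 := by
      rw [norm_smul, Real.norm_of_nonneg (sub_nonneg.2 (inv_le_one_of_one_le₀ hz)), sub_mul,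
        one_mul, inv_mul_cancel₀ hz0.ne']
    _ < δ := by linarith

theorem exists_continuation {Ω : Set ℂ} (hΩ : IsOpen Ω) (hstar : StarConvex ℝ 0 Ω)
    {f : ℂ → ℂ} (hf : ∀ z, ‖z‖ < 1 → AnalyticAt ℂ f z)
    (hloc : ∀ c : ℂ, ‖c‖ = 1 → ∃ r E, IsLocalContinuation Ω f c r E) :
    ∃ R : ℝ, 1 < R ∧ ∃ F : ℂ → ℂ, (∀ z ∈ Ω, ‖z‖ < R → AnalyticAt ℂ F z) ∧
      (∀ z, ‖z‖ < 1 → F z = f z) ∧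
      ∀ c r E, IsLocalContinuation Ω f c r E → ∀ z ∈ Metric.ball c r, z ∈ Ω → ‖z‖ < R →
        F z = E z := by
  choose r E hE using fun c : Metric.sphere (0 : ℂ) 1 => hloc c (mem_sphere_zero_iff_norm.1 c.2)
  obtain ⟨δ, hδ, hcover⟩ := exists_pos_annulus_subset_iUnion_ball fun c => (hE c).pos
  have : Nonempty (Metric.sphere (0 : ℂ) 1) := ⟨⟨1, by simp⟩⟩
  choose! k hk using hcover
  classical
  set F : ℂ → ℂ := fun z => if ‖z‖ < 1 then f z else E (k z) z
  have hFf : ∀ z, ‖z‖ < 1 → F z = f z := fun z hz => if_pos hz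
  have hFE : ∀ c r E, IsLocalContinuation Ω f c r E → ∀ z ∈ Metric.ball c r, z ∈ Ω →
      ‖z‖ < 1 + δ → F z = E z := by
    intro c r E h z hz hzΩ hzδ
    rcases lt_or_ge ‖z‖ 1 with hlt | hge
    · rw [hFf z hlt, h.eq z hz hlt]
    · exact (if_neg hge.not_gt).trans ((hE (k z)).eq_of_mem hstar h (hk z hge hzδ) hz hzΩ)
  refine ⟨1 + δ, by linarith, F, fun z hzΩ hzδ => ?_, hFf, hFE⟩
  rcases lt_or_ge ‖z‖ 1 with hlt | hge
  · refine (hf z hlt).congr ?_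
    filter_upwards [continuous_norm.continuousAt.eventually (gt_mem_nhds hlt)] with w hw
    exact (hFf w hw).symm
  · have hzk := hk z hge hzδ
    refine ((hE (k z)).analyticAt z hzk hzΩ).congr ?_
    filter_upwards [Metric.isOpen_ball.mem_nhds hzk, hΩ.mem_nhds hzΩ,
      continuous_norm.continuousAt.eventually (gt_mem_nhds hzδ)] with w hw hwΩ hwδ
    exact (hFE _ _ _ (hE (k z)) w hw hwΩ hwδ).symm

end Continuation

/-- The generating function `∑ₙ aₙ vⁿ`, as a function of a complex variable `v`. -/
noncomputable def ogf (a : ℕ → ℝ) (v : ℂ) : ℂ := ∑' n, (a n : ℂ) * v ^ n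

section Ogf

variable {a : ℕ → ℝ} {r : ℝ} {v : ℂ}

theorem ogf_zero (a : ℕ → ℝ) : ogf a 0 = a 0 := by
  rw [ogf, tsum_eq_single 0 fun n hn => by rw [zero_pow hn, mul_zero], pow_zero, mul_one]

theorem ogf_ofReal (a : ℕ → ℝ) (x : ℝ) : ogf a x = ((∑' n, a n * x ^ n : ℝ) : ℂ) := by
  rw [ogf, Complex.ofReal_tsum]
  push_cast
  rfl

theorem norm_ofReal_mul_pow_le (ha : ∀ n, 0 ≤ a n) (hv : ‖v‖ ≤ r) (n : ℕ) :
    ‖(a n : ℂ) * v ^ n‖ ≤ a n * r ^ n := by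
  rw [norm_mul, norm_pow, Complex.norm_real, Real.norm_of_nonneg (ha n)]
  exact mul_le_mul_of_nonneg_left (pow_le_pow_left₀ (norm_nonneg v) hv n) (ha n)

theorem hasSum_ogf (ha : ∀ n, 0 ≤ a n) (hsum : Summable fun n => a n * r ^ n) (hv : ‖v‖ ≤ r) :
    HasSum (fun n => (a n : ℂ) * v ^ n) (ogf a v) :=
  (Summable.of_norm_bounded hsum fun n => norm_ofReal_mul_pow_le ha hv n).hasSum

theorem norm_ogf_le (ha : ∀ n, 0 ≤ a n) (hsum : Summable fun n => a n * r ^ n) (hv : ‖v‖ ≤ r) :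
    ‖ogf a v‖ ≤ ∑' n, a n * r ^ n :=
  tsum_of_norm_bounded hsum.hasSum fun n => norm_ofReal_mul_pow_le ha hv n

theorem continuousOn_ogf (ha : ∀ n, 0 ≤ a n) (hsum : Summable fun n => a n * r ^ n) :
    ContinuousOn (ogf a) (Metric.closedBall 0 r) :=
  continuousOn_tsum (fun n => by fun_prop) hsum fun n _ hw =>
    norm_ofReal_mul_pow_le ha (mem_closedBall_zero_iff.1 hw) n

theorem analyticAt_ogf (ha : ∀ n, 0 ≤ a n) (hsum : Summable fun n => a n * r ^ n) (hv : ‖v‖ < r) :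
    AnalyticAt ℂ (ogf a) v :=
  (Complex.differentiableOn_tsum_of_summable_norm hsum (fun n => by fun_prop) Metric.isOpen_ball
    fun n _ hw => norm_ofReal_mul_pow_le ha (mem_ball_zero_iff.1 hw).le n).analyticAt
      (Metric.isOpen_ball.mem_nhds (mem_ball_zero_iff.2 hv))

theorem hasSum_deriv_ogf (ha : ∀ n, 0 ≤ a n) (hsum : Summable fun n => a n * r ^ n)
    (hv : ‖v‖ < r) : HasSum (fun n => (a n : ℂ) * (n * v ^ (n - 1))) (deriv (ogf a) v) := by
  refine (Complex.hasSum_deriv_of_summable_norm (F := fun n v => (a n : ℂ) * v ^ n) hsum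
    (fun n => by fun_prop) Metric.isOpen_ball (fun n _ hw =>
      norm_ofReal_mul_pow_le ha (mem_ball_zero_iff.1 hw).le n)
    (mem_ball_zero_iff.2 hv)).congr_fun fun n => ?_
  simp

theorem deriv_ogf (ha : ∀ n, 0 ≤ a n) (hsum : Summable fun n => a n * r ^ n) (hv : ‖v‖ < r) :
    deriv (ogf a) v = ogf (fun n => (n + 1) * a (n + 1)) v := by
  have hshift := (hasSum_nat_add_iff' 1).2 (hasSum_deriv_ogf ha hsum hv)
  simp only [Finset.sum_range_one, Nat.cast_zero, zero_mul, mul_zero, sub_zero,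
    Nat.add_sub_cancel] at hshift
  rw [ogf, ← hshift.tsum_eq]
  refine tsum_congr fun n => ?_
  push_cast
  ring

theorem summable_succ_mul_mul_pow (ha : ∀ n, 0 ≤ a n) (hsum : Summable fun n => a n * r ^ n)
    {r' : ℝ} (hr' : 0 ≤ r') (hr : r' < r) :
    Summable fun n : ℕ => ((n : ℝ) + 1) * a (n + 1) * r' ^ n := by
  have hnorm : ‖(r' : ℂ)‖ < r := by rwa [Complex.norm_real, Real.norm_of_nonneg hr']
  have hshift := (summable_nat_add_iff 1).2 (hasSum_deriv_ogf ha hsum hnorm).summable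
  rw [← Complex.summable_ofReal]
  refine hshift.congr fun n => ?_
  rw [Nat.add_sub_cancel]
  push_cast
  ring

theorem hasSum_deriv_deriv_ogf (ha : ∀ n, 0 ≤ a n) (hsum : Summable fun n => a n * r ^ n)
    (hv : ‖v‖ < r) :
    HasSum (fun n => (a n : ℂ) * (n * ((n - 1 : ℕ) * v ^ (n - 2)))) (deriv (deriv (ogf a)) v) := by
  obtain ⟨r', hvr', hr'⟩ := exists_between hv
  have hr'0 : 0 ≤ r' := (norm_nonneg v).trans hvr'.le
  have hderiv : deriv (ogf a) =ᶠ[𝓝 v] ogf (fun n => (n + 1) * a (n + 1)) := by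
    filter_upwards [continuous_norm.continuousAt.eventually (gt_mem_nhds hv)] with w hw
    exact deriv_ogf ha hsum hw
  rw [hderiv.deriv_eq, ← hasSum_nat_add_iff' 1]
  simp only [Finset.sum_range_one, Nat.cast_zero, zero_mul, mul_zero, sub_zero]
  refine (hasSum_deriv_ogf (fun n => mul_nonneg (by positivity) (ha (n + 1)))
    (summable_succ_mul_mul_pow ha hsum hr'0 hr') hvr').congr_fun fun n => ?_
  rw [Nat.add_sub_cancel, Nat.add_sub_add_right n 1 1]
  push_cast
  ring

end Ogf

theorem eq_one_of_norm_le_of_re_eq {u : ℂ} (hu : ‖u‖ ≤ 1) (hre : u.re = 1) : u = 1 := by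
  have hnorm : u.re = ‖u‖ := le_antisymm (Complex.re_le_norm u) (hre ▸ hu)
  exact Complex.ext hre (Complex.nonneg_iff.1 (Complex.re_eq_norm.1 hnorm)).2.symm

theorem eq_one_of_hasSum_mul_one_sub {ι : Type*} {p : ι → ℝ} {x : ι → ℂ} (hp : ∀ k, 0 ≤ p k)
    (hx : ∀ k, ‖x k‖ ≤ 1) (hsum : HasSum (fun k => (p k : ℂ) * (1 - x k)) 0) {k : ι}
    (hk : p k ≠ 0) : x k = 1 := by
  have hre := Complex.hasSum_re hsum
  simp only [Complex.re_ofReal_mul, Complex.sub_re, Complex.one_re, Complex.zero_re] at hre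
  have hzero := congrFun ((hasSum_zero_iff_of_nonneg fun k => mul_nonneg (hp k)
    (sub_nonneg.2 ((Complex.re_le_norm _).trans (hx k)))).1 hre) k
  have hsub := (mul_eq_zero.1 hzero).resolve_left hk
  exact eq_one_of_norm_le_of_re_eq (hx k) (sub_eq_zero.1 hsub).symm

theorem one_add_natCast_mul_sub_le_pow {y : ℝ} (hy : 0 ≤ y) (n : ℕ) :
    1 + (n : ℝ) * (y - 1) ≤ y ^ n := by
  simpa only [add_sub_cancel] using one_add_mul_le_pow (a := y - 1) (by linarith) n

theorem eq_one_of_pow_eq_one_add_mul {y : ℝ} (hy : 0 ≤ y) {n : ℕ} (hn : 2 ≤ n)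
    (heq : y ^ n = 1 + n * (y - 1)) : y = 1 := by
  obtain ⟨m, rfl⟩ := Nat.exists_eq_add_of_le' hn
  have hbernoulli := mul_le_mul_of_nonneg_right (one_add_natCast_mul_sub_le_pow hy (m + 1)) hy
  rw [← pow_succ, heq] at hbernoulli
  push_cast at hbernoulli
  have hnonpos : ((m : ℝ) + 1) * (y - 1) ^ 2 ≤ 0 := by linarith
  have hsq : (y - 1) ^ 2 ≤ 0 := nonpos_of_mul_nonpos_right hnonpos (by positivity)
  exact sub_eq_zero.1 (pow_eq_zero_iff two_ne_zero |>.1 (le_antisymm hsq (sq_nonneg _)))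

/-- Critical offspring weights of a branching process: `q k` is the probability of having `d * k`
children. The mean number of children is `1`, `V` is its variance, and the generating function of
`q` converges beyond the unit disc, at `r`. -/
structure IsCritical (d : ℕ) (q : ℕ → ℝ) (V r : ℝ) : Prop where
  d_pos : 0 < d
  nonneg : ∀ k, 0 ≤ q k
  zero_pos : 0 < q 0
  hasSum : HasSum q 1
  hasSum_mean : HasSum (fun k : ℕ => (d * k : ℝ) * q k) 1
  hasSum_variance : HasSum (fun k : ℕ => (d * k : ℝ) * (d * k - 1) * q k) V
  variance_pos : 0 < V
  one_lt : 1 < r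
  summable : Summable fun k => q k * r ^ k
  aperiodic : ∀ v : ℂ, (∀ k, q k ≠ 0 → v ^ k = 1) → v = 1

namespace IsCritical

variable {d : ℕ} {q : ℕ → ℝ} {V r : ℝ} {v : ℂ}

theorem hasSum_ogf (h : IsCritical d q V r) (hv : ‖v‖ ≤ 1) :
    HasSum (fun k => (q k : ℂ) * v ^ k) (ogf q v) :=
  CrossingFree.hasSum_ogf h.nonneg h.summable (hv.trans h.one_lt.le)

theorem analyticAt_ogf (h : IsCritical d q V r) (hv : ‖v‖ ≤ 1) : AnalyticAt ℂ (ogf q) v :=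
  CrossingFree.analyticAt_ogf h.nonneg h.summable (hv.trans_lt h.one_lt)

theorem hasSum_deriv_ogf (h : IsCritical d q V r) (hv : ‖v‖ ≤ 1) :
    HasSum (fun k => (q k : ℂ) * (k * v ^ (k - 1))) (deriv (ogf q) v) :=
  CrossingFree.hasSum_deriv_ogf h.nonneg h.summable (hv.trans_lt h.one_lt)

theorem ogf_one (h : IsCritical d q V r) : ogf q 1 = 1 := by
  rw [← Complex.ofReal_one, ogf_ofReal]
  simp only [one_pow, mul_one, h.hasSum.tsum_eq]

theorem deriv_ogf_one (h : IsCritical d q V r) : d * deriv (ogf q) 1 = 1 := by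
  refine ((h.hasSum_deriv_ogf norm_one.le).mul_left (d : ℂ)).unique ?_
  have hmean := Complex.hasSum_ofReal.2 h.hasSum_mean
  rw [Complex.ofReal_one] at hmean
  refine hmean.congr_fun fun k => ?_
  push_cast
  rw [one_pow]
  ring

theorem deriv_deriv_ogf_one (h : IsCritical d q V r) :
    (d : ℂ) ^ 2 * deriv (deriv (ogf q)) 1 + (d - 1) = V := by
  have hderiv := (hasSum_deriv_deriv_ogf (v := 1) h.nonneg h.summable
    (norm_one.trans_lt h.one_lt)).mul_left ((d : ℂ) ^ 2)
  have hmean := (Complex.hasSum_ofReal.2 h.hasSum_mean).mul_left ((d : ℂ) - 1)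
  rw [Complex.ofReal_one, mul_one] at hmean
  refine (hderiv.add hmean).unique
    ((Complex.hasSum_ofReal.2 h.hasSum_variance).congr_fun fun k => ?_)
  rcases k with _ | k
  · simp
  · push_cast
    rw [one_pow]
    ring

theorem exists_two_le (h : IsCritical d q V r) : ∃ k, q k ≠ 0 ∧ 2 ≤ d * k := by
  by_contra! hsmall
  have hterm : ∀ k : ℕ, (d * k : ℝ) * (d * k - 1) * q k = 0 := by
    intro k
    rcases eq_or_ne (q k) 0 with hq | hq
    · rw [hq, mul_zero]
    have hk : d * k = 0 ∨ d * k = 1 := Nat.le_one_iff_eq_zero_or_eq_one.1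
      (Nat.lt_succ_iff.1 (hsmall k hq))
    rw [← Nat.cast_mul]
    rcases hk with hk | hk <;> simp [hk]
  have hV := h.hasSum_variance
  simp only [hterm] at hV
  exact h.variance_pos.ne' (hV.unique hasSum_zero)

/-- By criticality, the tangent at `1` to `y ↦ ogf q (y ^ d)` is the diagonal, and the term with
`d * k ≥ 2` makes this function strictly convex. -/
theorem eq_one_of_ogf_pow_eq (h : IsCritical d q V r) {y : ℝ} (hy0 : 0 ≤ y) (hy1 : y ≤ 1)
    (hfix : ogf q ((y : ℂ) ^ d) = y) : y = 1 := by
  have hnorm : ‖(y : ℂ) ^ d‖ ≤ 1 := by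
    rw [norm_pow, Complex.norm_real, Real.norm_of_nonneg hy0]
    exact pow_le_one₀ hy0 hy1
  have hsum : HasSum (fun k => q k * (y ^ d) ^ k) y := by
    rw [← Complex.hasSum_ofReal, ← hfix]
    exact_mod_cast h.hasSum_ogf hnorm
  have hgap : HasSum (fun k => q k * (y ^ (d * k) - (1 + (d * k : ℕ) * (y - 1)))) 0 := by
    have hdiff := hsum.sub (h.hasSum.add (h.hasSum_mean.mul_right (y - 1)))
    rw [one_mul, add_sub_cancel, sub_self] at hdiff
    refine hdiff.congr_fun fun k => ?_
    rw [pow_mul]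
    push_cast
    ring
  have hgap_nonneg := fun k => mul_nonneg (h.nonneg k)
    (sub_nonneg.2 (one_add_natCast_mul_sub_le_pow hy0 (d * k)))
  obtain ⟨k, hqk, hk⟩ := h.exists_two_le
  have hzero := congrFun ((hasSum_zero_iff_of_nonneg hgap_nonneg).1 hgap) k
  exact eq_one_of_pow_eq_one_add_mul hy0 hk
    (sub_eq_zero.1 ((mul_eq_zero.1 hzero).resolve_left hqk))

/-- Since `u⁰ = 1`, truncating `d * k - 1` at `k = 0` only serves to make the weights
nonnegative. -/
theorem hasSum_mul_one_sub_pow (h : IsCritical d q V r) {u : ℂ} (hu : ‖u‖ ≤ 1)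
    (hcrit : ogf q u = d * u * deriv (ogf q) u) :
    HasSum (fun k : ℕ => (((d * k - 1 : ℕ) * q k : ℝ) : ℂ) * (1 - u ^ k)) 0 := by
  have hweight := Complex.hasSum_ofReal.2 (h.hasSum_mean.sub h.hasSum)
  have hdiff := hweight.sub (((h.hasSum_deriv_ogf hu).mul_left (d * u)).sub (h.hasSum_ogf hu))
  rw [← hcrit, sub_self, sub_self, Complex.ofReal_zero, sub_self] at hdiff
  refine hdiff.congr_fun fun k => ?_
  rcases k with _ | k
  · simp
  · push_cast [Nat.cast_sub (Nat.mul_pos h.d_pos k.succ_pos)]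
    simp only [pow_succ]
    ring

theorem norm_eq_one_of_ogf_eq_mul_deriv (h : IsCritical d q V r) {u : ℂ} (hu : ‖u‖ ≤ 1)
    (hcrit : ogf q u = d * u * deriv (ogf q) u) : ‖u‖ = 1 := by
  obtain ⟨k, hqk, hk⟩ := h.exists_two_le
  have hk0 : k ≠ 0 := by
    rintro rfl
    simp at hk
  have hweight : ((d * k - 1 : ℕ) * q k : ℝ) ≠ 0 :=
    mul_ne_zero (Nat.cast_ne_zero.2 (Nat.sub_ne_zero_of_lt hk)) hqk
  have hpow : u ^ k = 1 := eq_one_of_hasSum_mul_one_sub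
    (fun k => mul_nonneg (Nat.cast_nonneg _) (h.nonneg k))
    (fun k => (norm_pow u k).trans_le (pow_le_one₀ (norm_nonneg u) hu))
    (h.hasSum_mul_one_sub_pow hu hcrit) hweight
  exact Complex.norm_eq_one_of_pow_eq_one hpow hk0

/-- The value `w = ogf q u` is a convex combination of the points `u ^ k` of the closed unit disc,
among which `u ^ 0 = 1`; it lies on the circle only if these points all coincide. -/
theorem eq_one_of_norm_ogf_eq_one (h : IsCritical d q V r) {u : ℂ} (hu : ‖u‖ ≤ 1)
    (hw : ‖ogf q u‖ = 1) : u = 1 := by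
  have hmul : ogf q u * starRingEnd ℂ (ogf q u) = 1 := by
    rw [Complex.mul_conj, Complex.normSq_eq_norm_sq, hw, one_pow, Complex.ofReal_one]
  have hsum : HasSum (fun k => (q k : ℂ) * (1 - u ^ k * starRingEnd ℂ (ogf q u))) 0 := by
    have hdiff := (Complex.hasSum_ofReal.2 h.hasSum).sub
      ((h.hasSum_ogf hu).mul_right (starRingEnd ℂ (ogf q u)))
    rw [hmul, Complex.ofReal_one, sub_self] at hdiff
    exact hdiff.congr_fun fun k => by ring
  have hnorm : ∀ k, ‖u ^ k * starRingEnd ℂ (ogf q u)‖ ≤ 1 := fun k => by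
    rw [norm_mul, Complex.norm_conj, hw, mul_one, norm_pow]
    exact pow_le_one₀ (norm_nonneg u) hu
  have hone : ∀ k, q k ≠ 0 → u ^ k * starRingEnd ℂ (ogf q u) = 1 := fun k hk =>
    eq_one_of_hasSum_mul_one_sub h.nonneg hnorm hsum hk
  have hconj : starRingEnd ℂ (ogf q u) = 1 := by
    simpa only [pow_zero, one_mul] using hone 0 h.zero_pos.ne'
  exact h.aperiodic u fun k hk => by simpa only [hconj, mul_one] using hone k hk

theorem eq_one_of_ogf_eq_mul_deriv (h : IsCritical d q V r) {z u : ℂ} (hz : ‖z‖ ≤ 1)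
    (hu : ‖u‖ ≤ 1) (hfix : z * ogf q u ^ d = u) (hw : ‖ogf q u‖ ≤ 1)
    (hcrit : ogf q u = d * u * deriv (ogf q) u) : z = 1 := by
  have hnorm : ‖z‖ * ‖ogf q u‖ ^ d = 1 := by
    rw [← norm_pow, ← norm_mul, hfix, h.norm_eq_one_of_ogf_eq_mul_deriv hu hcrit]
  have hle : ‖ogf q u‖ ^ d ≤ 1 := pow_le_one₀ (norm_nonneg _) hw
  have hge : 1 ≤ ‖ogf q u‖ ^ d := hnorm ▸ mul_le_of_le_one_left (by positivity) hz
  have hw1 : ‖ogf q u‖ = 1 :=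
    (pow_eq_one_iff_of_nonneg (norm_nonneg _) h.d_pos.ne').1 (le_antisymm hle hge)
  rwa [h.eq_one_of_norm_ogf_eq_one hu hw1, h.ogf_one, one_pow, mul_one] at hfix

theorem hasDerivAt_ogf_pow (h : IsCritical d q V r) (hv : ‖v‖ ≤ 1) :
    HasDerivAt (fun v => ogf q v ^ d) (d * ogf q v ^ (d - 1) * deriv (ogf q) v) v :=
  (h.analyticAt_ogf hv).differentiableAt.hasDerivAt.pow d

theorem deriv_ogf_pow_one (h : IsCritical d q V r) : deriv (fun v => ogf q v ^ d) 1 = 1 := by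
  rw [(h.hasDerivAt_ogf_pow norm_one.le).deriv, h.ogf_one, one_pow, mul_one, h.deriv_ogf_one]

theorem deriv_deriv_ogf_pow_one (h : IsCritical d q V r) :
    deriv (deriv fun v => ogf q v ^ d) 1 = ((V / d : ℝ) : ℂ) := by
  have han : ∀ᶠ v in 𝓝 (1 : ℂ), DifferentiableAt ℂ (ogf q) v :=
    (h.analyticAt_ogf norm_one.le).eventually_analyticAt.mono fun _ hv => hv.differentiableAt
  have hderiv : deriv (fun v => ogf q v ^ d) =ᶠ[𝓝 1]
      fun v => d * ogf q v ^ (d - 1) * deriv (ogf q) v := by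
    filter_upwards [han] with v hv
    exact (hv.hasDerivAt.pow d).deriv
  have hogf := h.analyticAt_ogf (v := 1) norm_one.le
  rw [hderiv.deriv_eq]
  refine (((hogf.differentiableAt.hasDerivAt.pow (d - 1)).const_mul (d : ℂ)).mul
    hogf.deriv.differentiableAt.hasDerivAt).deriv.trans ?_
  have hd : (d : ℂ) ≠ 0 := Nat.cast_ne_zero.2 h.d_pos.ne'
  simp only [Pi.pow_apply, h.ogf_one, one_pow, mul_one, Nat.cast_pred h.d_pos]
  push_cast
  rw [eq_div_iff hd, ← h.deriv_deriv_ogf_one]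
  linear_combination ((d : ℂ) - 1) * (d * deriv (ogf q) 1 + 1) * h.deriv_ogf_one

end IsCritical

theorem isOpen_one_sub_mem_slitPlane : IsOpen {z : ℂ | 1 - z ∈ Complex.slitPlane} :=
  Complex.isOpen_slitPlane.preimage (continuous_const.sub continuous_id)

theorem starConvex_one_sub_mem_slitPlane :
    StarConvex ℝ 0 {z : ℂ | 1 - z ∈ Complex.slitPlane} := by
  rw [starConvex_zero_iff]
  intro z hz t ht0 ht1
  have hmem := Complex.starConvex_one_slitPlane.add_smul_sub_mem hz ht0 ht1
  rwa [sub_sub_cancel_left, smul_neg, ← sub_eq_add_neg] at hmem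

/-- Nonnegative coefficients `c` of total mass at most `1` whose generating function `Q = ogf c`
solves `Q = ogf q (z * Q ^ d)` on the closed unit disc. For offspring weights `q`, this is the
equation for the total progeny of the branching process. -/
structure IsSolution (d : ℕ) (q c : ℕ → ℝ) : Prop where
  nonneg : ∀ n, 0 ≤ c n
  summable : Summable c
  tsum_le : ∑' n, c n ≤ 1
  eq : ∀ z : ℂ, ‖z‖ ≤ 1 → ogf q (z * ogf c z ^ d) = ogf c z

namespace IsSolution

variable {d : ℕ} {q c : ℕ → ℝ} {V r : ℝ} {z : ℂ}

theorem summable_mul_one_pow (h : IsSolution d q c) : Summable fun n => c n * 1 ^ n := by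
  simpa only [one_pow, mul_one] using h.summable

theorem hasSum (h : IsSolution d q c) (hz : ‖z‖ ≤ 1) :
    HasSum (fun n => (c n : ℂ) * z ^ n) (ogf c z) :=
  hasSum_ogf h.nonneg h.summable_mul_one_pow hz

theorem norm_le_one (h : IsSolution d q c) (hz : ‖z‖ ≤ 1) : ‖ogf c z‖ ≤ 1 := by
  refine (norm_ogf_le h.nonneg h.summable_mul_one_pow hz).trans ?_
  simpa only [one_pow, mul_one] using h.tsum_le

theorem analyticAt (h : IsSolution d q c) (hz : ‖z‖ < 1) : AnalyticAt ℂ (ogf c) z :=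
  analyticAt_ogf h.nonneg h.summable_mul_one_pow hz

theorem norm_mul_pow_le (h : IsSolution d q c) (hz : ‖z‖ ≤ 1) : ‖z * ogf c z ^ d‖ ≤ 1 := by
  rw [norm_mul, norm_pow]
  exact mul_le_one₀ hz (by positivity) (pow_le_one₀ (norm_nonneg _) (h.norm_le_one hz))

theorem continuousWithinAt_mul_pow (h : IsSolution d q c) (hz : ‖z‖ ≤ 1) :
    ContinuousWithinAt (fun z => z * ogf c z ^ d) (Metric.closedBall 0 1) z :=
  (continuousOn_id.mul ((continuousOn_ogf h.nonneg h.summable_mul_one_pow).pow d)) z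
    (mem_closedBall_zero_iff.2 hz)

theorem mul_pow_eq (h : IsSolution d q c) (z : ℂ) (hz : ‖z‖ ≤ 1) :
    z * ogf c z ^ d = z * ogf q (z * ogf c z ^ d) ^ d := by
  rw [h.eq z hz]

theorem apply_one (h : IsSolution d q c) (hq : IsCritical d q V r) : ogf c 1 = 1 := by
  have hreal : ogf c 1 = ((∑' n, c n : ℝ) : ℂ) := by
    rw [← Complex.ofReal_one, ogf_ofReal]
    simp only [one_pow, mul_one]
  have hfix := h.eq 1 norm_one.le
  rw [one_mul, hreal] at hfix
  rw [hreal, hq.eq_one_of_ogf_pow_eq (tsum_nonneg h.nonneg) h.tsum_le hfix, Complex.ofReal_one]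

theorem ne_zero (h : IsSolution d q c) (hq : IsCritical d q V r) (hz : ‖z‖ ≤ 1) :
    ogf c z ≠ 0 := by
  intro hzero
  have hfix := h.eq z hz
  rw [hzero, zero_pow hq.d_pos.ne', mul_zero, ogf_zero, Complex.ofReal_eq_zero] at hfix
  exact hq.zero_pos.ne' hfix

theorem pow_ne_mul_deriv (h : IsSolution d q c) (hq : IsCritical d q V r) (hz : ‖z‖ ≤ 1)
    (hz1 : z ≠ 1) : ogf q (z * ogf c z ^ d) ^ d ≠
      z * ogf c z ^ d * deriv (fun u => ogf q u ^ d) (z * ogf c z ^ d) := by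
  have hu := h.norm_mul_pow_le hz
  rw [(hq.hasDerivAt_ogf_pow hu).deriv]
  refine fun hcrit => hz1 (hq.eq_one_of_ogf_eq_mul_deriv hz hu (by rw [h.eq z hz])
    (by rw [h.eq z hz]; exact h.norm_le_one hz) ?_)
  have hpow : ogf q (z * ogf c z ^ d) ^ (d - 1) ≠ 0 := by
    rw [h.eq z hz]
    exact pow_ne_zero _ (h.ne_zero hq hz)
  refine mul_left_cancel₀ hpow ?_
  rw [← pow_succ, Nat.sub_add_cancel hq.d_pos, hcrit]
  ring

theorem exists_isLocalContinuation (h : IsSolution d q c) (hq : IsCritical d q V r)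
    (hz : ‖z‖ = 1) (hz1 : z ≠ 1) (Ω : Set ℂ) :
    ∃ ε E, IsLocalContinuation Ω (ogf c) z ε E := by
  have hu := h.norm_mul_pow_le hz.le
  obtain ⟨E, hE, hEz, hEv⟩ := exists_analyticAt_of_noncritical (v := fun z => z * ogf c z ^ d)
    ((hq.analyticAt_ogf hu).pow d)
    (by simpa only [Pi.pow_apply, h.eq z hz.le] using pow_ne_zero d (h.ne_zero hq hz.le))
    (h.pow_ne_mul_deriv hq hz.le hz1) hz.le (h.continuousWithinAt_mul_pow hz.le) h.mul_pow_eq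
  obtain ⟨ε, hε⟩ := IsLocalContinuation.of_eventually (Ω := Ω) (f := ogf c)
    (E := fun z => ogf q (E z)) hz
    (((hq.analyticAt_ogf hu).comp_of_eq hE hEz).eventually_analyticAt.mono fun _ hw _ => hw)
    (hEv.mono fun w hw hw1 => by rw [hw hw1.le, h.eq w hw1.le])
  exact ⟨ε, _, hε⟩

/-- The constant combines `deriv (ogf q) 1 = d⁻¹` with the second derivative `V / d` of
`ogf q ^ d` at `1`. -/
theorem exists_sqrt_expansion (h : IsSolution d q c) (hq : IsCritical d q V r) :
    ∃ T : ℂ → ℂ, AnalyticAt ℂ T 0 ∧ T 0 = 1 ∧ deriv T 0 = -((√(2 / (d * V)) : ℝ) : ℂ) ∧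
      ∀ᶠ z in 𝓝 (1 : ℂ), ‖z‖ ≤ 1 → ogf c z = T (Complex.sqrt (1 - z)) := by
  have hd : (0 : ℝ) < d := Nat.cast_pos.2 hq.d_pos
  have hogf := hq.analyticAt_ogf (v := 1) norm_one.le
  obtain ⟨χ, hχ, hχ0, hχ', hχv⟩ := exists_sqrt_expansion_of_critical
    (Φ := fun u => ogf q u ^ d) (v := fun z => z * ogf c z ^ d) (κ := V / d) (hogf.pow d)
    (by rw [hq.ogf_one, one_pow]) hq.deriv_ogf_pow_one hq.deriv_deriv_ogf_pow_one
    (div_pos hq.variance_pos hd) (by rw [h.apply_one hq, one_pow, one_mul])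
    (h.continuousWithinAt_mul_pow norm_one.le) (fun z hz => h.norm_mul_pow_le hz) h.mul_pow_eq
  refine ⟨ogf q ∘ χ, hogf.comp_of_eq hχ hχ0, by rw [Function.comp_apply, hχ0, hq.ogf_one], ?_, ?_⟩
  · have hchain : deriv (ogf q ∘ χ) 0 = deriv (ogf q) (χ 0) * deriv χ 0 :=
      deriv_comp 0 (by rw [hχ0]; exact hogf.differentiableAt) hχ.differentiableAt
    have hderiv : deriv (ogf q) 1 = ((d⁻¹ : ℝ) : ℂ) := by
      push_cast
      exact eq_inv_of_mul_eq_one_right hq.deriv_ogf_one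
    have hsqrt : √(2 / (d * V)) = (d : ℝ)⁻¹ * √(2 / (V / d)) := by
      have hV := hq.variance_pos.ne'
      rw [← Real.sqrt_sq (inv_nonneg.2 hd.le), ← Real.sqrt_mul (sq_nonneg _)]
      congr 1
      field_simp
    rw [hchain, hχ0, hderiv, hχ', hsqrt, mul_neg, Complex.ofReal_mul]
  · filter_upwards [hχv] with z hz hz1
    rw [Function.comp_apply, ← hz hz1, h.eq z hz1]

theorem exists_continuation (h : IsSolution d q c) (hq : IsCritical d q V r) :
    ∃ R : ℝ, 1 < R ∧ ∃ F T : ℂ → ℂ,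
      (∀ z, 1 - z ∈ Complex.slitPlane → ‖z‖ < R → AnalyticAt ℂ F z) ∧
      (∀ z, ‖z‖ < 1 → F z = ogf c z) ∧ AnalyticAt ℂ T 0 ∧ T 0 = 1 ∧
      deriv T 0 = -((√(2 / (d * V)) : ℝ) : ℂ) ∧
      ∀ᶠ z in 𝓝 (1 : ℂ), 1 - z ∈ Complex.slitPlane → F z = T (Complex.sqrt (1 - z)) := by
  obtain ⟨T, hT, hT0, hT', hcT⟩ := h.exists_sqrt_expansion hq
  obtain ⟨ε, hε⟩ := IsLocalContinuation.of_eventually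
    (Ω := {z : ℂ | 1 - z ∈ Complex.slitPlane}) (f := ogf c)
    (E := fun z => T (Complex.sqrt (1 - z))) norm_one
    ((tendsto_sqrt_one_sub.eventually hT.eventually_analyticAt).mono fun z hz hzΩ =>
      hz.comp_of_eq (analyticAt_sqrt_one_sub hzΩ) rfl)
    (hcT.mono fun z hz hz1 => (hz hz1.le).symm)
  obtain ⟨R, hR, F, hF, hFc, hFE⟩ := CrossingFree.exists_continuation
    isOpen_one_sub_mem_slitPlane starConvex_one_sub_mem_slitPlane (fun z hz => h.analyticAt hz)
    fun z hz => by
      rcases eq_or_ne z 1 with rfl | hz1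
      · exact ⟨ε, _, hε⟩
      · exact h.exists_isLocalContinuation hq hz hz1 _
  have hnorm : ∀ᶠ z in 𝓝 (1 : ℂ), ‖z‖ < R :=
    continuous_norm.continuousAt.eventually (gt_mem_nhds (norm_one.trans_lt hR))
  refine ⟨R, hR, F, T, hF, hFc, hT, hT0, hT', ?_⟩
  filter_upwards [Metric.ball_mem_nhds (1 : ℂ) hε.pos, hnorm] with z hz hzR hzΩ
  exact hFE _ _ _ hε z hz hzΩ hzR

end IsSolution

/-- The offspring weights read off the equation `P = 1 + ∑_{s ∈ S} (x P) ^ s`: at `x = rho S`,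
where `P = alpha S` and `x P = tau S`, the terms on the right divided by their sum `alpha S` are a
probability distribution on `S ∪ {0}`. The index `k` stands for `gcd S * k` children. -/
noncomputable def weight (S : Set ℕ) (k : ℕ) : ℝ :=
  (alpha S)⁻¹ * ((if k = 0 then 1 else 0) + S.indicator (fun s => tau S ^ s) (Nat.setGcd S * k))

/-- The variance of the offspring distribution `weight S`. -/
noncomputable def weightVariance (S : Set ℕ) : ℝ :=
  (alpha S)⁻¹ * ∑' s : S, ((s : ℕ) : ℝ) * (((s : ℕ) : ℝ) - 1) * tau S ^ (s : ℕ)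

theorem eq_one_of_pow_eq_one_of_setGcd_mul_mem {M : Type*} [Monoid M] {S : Set ℕ}
    (hS : 0 < Nat.setGcd S) {v : M} (hv : ∀ k, Nat.setGcd S * k ∈ S → v ^ k = 1) : v = 1 := by
  have hdvd : Nat.setGcd S * orderOf v ∣ Nat.setGcd S * 1 := by
    rw [mul_one, Nat.dvd_setGcd_iff]
    intro s hs
    obtain ⟨k, rfl⟩ := Nat.setGcd_dvd_of_mem hs
    exact Nat.mul_dvd_mul_left _ (orderOf_dvd_of_pow_eq_one (hv k hs))
  exact orderOf_eq_one_iff.1 (Nat.dvd_one.1 (Nat.dvd_of_mul_dvd_mul_left hS hdvd))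

namespace IsAdmissible

variable {S : Set ℕ}

theorem setGcd_pos (h : IsAdmissible S) : 0 < Nat.setGcd S := by
  obtain ⟨s, hs⟩ := h.exists_two_le
  exact Nat.pos_of_dvd_of_pos (Nat.setGcd_dvd_of_mem s.2) (two_pos.trans_le hs)

theorem injective_setGcd_mul (h : IsAdmissible S) : Function.Injective (Nat.setGcd S * ·) :=
  mul_right_injective₀ h.setGcd_pos.ne'

theorem weight_nonneg (h : IsAdmissible S) (k : ℕ) : 0 ≤ weight S k :=
  mul_nonneg (inv_nonneg.2 h.alpha_pos.le) (add_nonneg (by split_ifs <;> norm_num)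
    (Set.indicator_nonneg (fun s _ => pow_nonneg h.tau_pos.le s) _))

theorem weight_zero_pos (h : IsAdmissible S) : 0 < weight S 0 := by
  rw [weight, mul_zero, if_pos rfl, Set.indicator_of_notMem h.zero_notMem, add_zero, mul_one]
  exact inv_pos.2 h.alpha_pos

theorem weight_pos_of_mem (h : IsAdmissible S) {k : ℕ} (hk : Nat.setGcd S * k ∈ S) :
    0 < weight S k := by
  rw [weight, Set.indicator_of_mem hk]
  exact mul_pos (inv_pos.2 h.alpha_pos)
    (add_pos_of_nonneg_of_pos (by split_ifs <;> norm_num) (pow_pos h.tau_pos _))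

theorem hasSum_weight_smul (h : IsAdmissible S) {E : Type*} [NormedAddCommGroup E]
    [NormedSpace ℝ E] {g : ℕ → E} {a : E} (hg : HasSum (fun s : S => tau S ^ (s : ℕ) • g s) a) :
    HasSum (fun k => weight S k • g (Nat.setGcd S * k)) ((alpha S)⁻¹ • (g 0 + a)) := by
  have hind := (hasSum_subtype_iff_indicator (f := fun n : ℕ => tau S ^ n • g n)).1 hg
  have hmultiples := (h.injective_setGcd_mul.hasSum_iff fun n hn =>
    Set.indicator_of_notMem (fun hnS => hn ((Nat.setGcd_dvd_of_mem hnS).imp fun _ => Eq.symm))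
      _).2 hind
  refine (((hasSum_ite_eq 0 (g 0)).add hmultiples).const_smul (alpha S)⁻¹).congr_fun fun k => ?_
  rw [weight, mul_smul, add_smul, Function.comp_apply, Set.indicator_smul_apply_left]
  split_ifs with hk
  · rw [hk, mul_zero, one_smul]
  · rw [zero_smul]

theorem hasSum_weight (h : IsAdmissible S) : HasSum (weight S) 1 := by
  have hsum := h.hasSum_weight_smul (g := fun _ => (1 : ℝ))
    (h.hasSum_tau_pow.congr_fun fun s => by rw [smul_eq_mul, mul_one])
  simpa only [smul_eq_mul, mul_one, add_sub_cancel, inv_mul_cancel₀ h.alpha_pos.ne'] using hsum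

theorem hasSum_weight_mean (h : IsAdmissible S) :
    HasSum (fun k : ℕ => (Nat.setGcd S * k : ℝ) * weight S k) 1 := by
  have hsum := h.hasSum_weight_smul (g := fun n : ℕ => (n : ℝ))
    (h.hasSum_mul_tau_pow.congr_fun fun s => mul_comm _ _)
  rw [Nat.cast_zero, zero_add, smul_eq_mul, inv_mul_cancel₀ h.alpha_pos.ne'] at hsum
  refine hsum.congr_fun fun k => ?_
  rw [smul_eq_mul, mul_comm, Nat.cast_mul]

theorem hasSum_weight_variance (h : IsAdmissible S) :
    HasSum (fun k : ℕ => (Nat.setGcd S * k : ℝ) * (Nat.setGcd S * k - 1) * weight S k)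
      (weightVariance S) := by
  have hsum := h.hasSum_weight_smul (g := fun n : ℕ => (n : ℝ) * ((n : ℝ) - 1))
    (h.summable_mul_sub_one_mul_tau_pow.hasSum.congr_fun fun s => mul_comm _ _)
  rw [Nat.cast_zero, zero_mul, zero_add] at hsum
  refine hsum.congr_fun fun k => ?_
  rw [smul_eq_mul, mul_comm, Nat.cast_mul]

theorem weightVariance_pos (h : IsAdmissible S) : 0 < weightVariance S :=
  mul_pos (inv_pos.2 h.alpha_pos) h.tsum_mul_sub_one_mul_tau_pow_pos

theorem exists_isCritical (h : IsAdmissible S) :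
    ∃ r, IsCritical (Nat.setGcd S) (weight S) (weightVariance S) r := by
  obtain ⟨r, hr, hsum⟩ := h.exists_tau_lt_summable
  have hsmul := h.hasSum_weight_smul (g := fun n : ℕ => (r / tau S) ^ n)
    (hsum.hasSum.congr_fun fun s => by
      rw [smul_eq_mul, ← mul_pow, mul_div_cancel₀ _ h.tau_pos.ne'])
  exact ⟨(r / tau S) ^ Nat.setGcd S,
    { d_pos := h.setGcd_pos
      nonneg := h.weight_nonneg
      zero_pos := h.weight_zero_pos
      hasSum := h.hasSum_weight
      hasSum_mean := h.hasSum_weight_mean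
      hasSum_variance := h.hasSum_weight_variance
      variance_pos := h.weightVariance_pos
      one_lt := one_lt_pow₀ ((one_lt_div h.tau_pos).2 hr) h.setGcd_pos.ne'
      summable := hsmul.summable.congr fun k => by rw [smul_eq_mul, pow_mul]
      aperiodic := fun _ hv => eq_one_of_pow_eq_one_of_setGcd_mul_mem h.setGcd_pos
        fun k hk => hv k (h.weight_pos_of_mem hk).ne' }⟩

end IsAdmissible

/-- The coefficients of the generating function along the multiples of `gcd S`, normalised to be
the coefficients of `(alpha S)⁻¹ * P (rho S * w)` as a function of `w ^ gcd S`. -/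
noncomputable def normCoeff (S : Set ℕ) (n : ℕ) : ℝ :=
  (alpha S)⁻¹ * (((PowerSeries.coeff (Nat.setGcd S * n) (genFun S) : ℕ) : ℝ) *
    rho S ^ (Nat.setGcd S * n))

theorem coeff_genFun_eq_zero_of_not_setGcd_dvd {S : Set ℕ} {n : ℕ} (hn : ¬ Nat.setGcd S ∣ n) :
    PowerSeries.coeff n (genFun S) = 0 := by
  rw [genFun, PowerSeries.coeff_mk, count_eq_zero_of_not_setGcd_dvd hn]

theorem exists_pow_eq_of_norm_le_one {d : ℕ} (hd : 0 < d) {z : ℂ} (hz : ‖z‖ ≤ 1) :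
    ∃ w : ℂ, ‖w‖ ≤ 1 ∧ w ^ d = z := by
  obtain ⟨w, rfl⟩ := IsAlgClosed.exists_pow_nat_eq z hd
  rw [norm_pow] at hz
  exact ⟨w, (pow_le_one_iff_of_nonneg (norm_nonneg w) hd.ne').1 hz, rfl⟩

namespace IsAdmissible

variable {S : Set ℕ} {w : ℂ}

theorem hasSum_setGcd_mul_iff (h : IsAdmissible S) {E : Type*} [AddCommMonoid E]
    [TopologicalSpace E] {g : ℕ → E} {a : E} (hg : ∀ n, ¬ Nat.setGcd S ∣ n → g n = 0) :
    HasSum (fun n => g (Nat.setGcd S * n)) a ↔ HasSum g a :=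
  h.injective_setGcd_mul.hasSum_iff fun n hn => hg n fun hdvd => hn (hdvd.imp fun _ => Eq.symm)

theorem hasSum_normCoeff (h : IsAdmissible S) : HasSum (normCoeff S)
    ((alpha S)⁻¹ * ∑' n, ((PowerSeries.coeff n (genFun S) : ℕ) : ℝ) * rho S ^ n) :=
  ((h.hasSum_setGcd_mul_iff fun n hn => by
    rw [coeff_genFun_eq_zero_of_not_setGcd_dvd hn, Nat.cast_zero, zero_mul]).2
      h.summable_coeff_genFun.hasSum).mul_left (alpha S)⁻¹

theorem norm_rho_mul_le (h : IsAdmissible S) (hw : ‖w‖ ≤ 1) : ‖(rho S : ℂ) * w‖ ≤ rho S := by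
  rw [norm_mul, Complex.norm_real, Real.norm_of_nonneg h.rho_pos.le]
  exact mul_le_of_le_one_right h.rho_pos.le hw

theorem tsum_coeff_genFun_rho_mul (h : IsAdmissible S) (hw : ‖w‖ ≤ 1) :
    ∑' n, ((PowerSeries.coeff n (genFun S) : ℕ) : ℂ) * ((rho S : ℂ) * w) ^ n =
      alpha S * ogf (normCoeff S) (w ^ Nat.setGcd S) := by
  have hmultiples := (h.hasSum_setGcd_mul_iff fun n hn => by
    rw [coeff_genFun_eq_zero_of_not_setGcd_dvd hn, Nat.cast_zero, zero_mul]).2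
      (h.hasAbsEval_genFun (h.norm_rho_mul_le hw)).hasSum
  have hα : (alpha S : ℂ) ≠ 0 := Complex.ofReal_ne_zero.2 h.alpha_pos.ne'
  rw [← inv_mul_eq_iff_eq_mul₀ hα, ← (hmultiples.mul_left (alpha S : ℂ)⁻¹).tsum_eq, ogf]
  refine tsum_congr fun n => ?_
  rw [normCoeff, mul_pow, ← pow_mul]
  push_cast
  ring

theorem ogf_weight_eq (h : IsAdmissible S) (hw : ‖w‖ ≤ 1) :
    ogf (weight S) (w ^ Nat.setGcd S * ogf (normCoeff S) (w ^ Nat.setGcd S) ^ Nat.setGcd S) =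
      ogf (normCoeff S) (w ^ Nat.setGcd S) := by
  have hα : (alpha S : ℂ) ≠ 0 := Complex.ofReal_ne_zero.2 h.alpha_pos.ne'
  have hblock := h.hasSum_mul_genFun_pow (h.norm_rho_mul_le hw)
  rw [h.tsum_coeff_genFun_rho_mul hw] at hblock
  set Q := ogf (normCoeff S) (w ^ Nat.setGcd S)
  have hweight := h.hasSum_weight_smul (g := fun n => (w * Q) ^ n)
    (hblock.congr_fun fun s => by
      rw [Complex.real_smul, Complex.ofReal_pow, ← mul_pow, ← h.rho_mul_alpha]
      push_cast
      ring)
  rw [pow_zero, add_sub_cancel, Complex.real_smul, Complex.ofReal_inv,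
    inv_mul_cancel_left₀ hα] at hweight
  rw [ogf, ← mul_pow]
  exact (tsum_congr fun k => by rw [Complex.real_smul, pow_mul]).trans hweight.tsum_eq

theorem isSolution (h : IsAdmissible S) :
    IsSolution (Nat.setGcd S) (weight S) (normCoeff S) where
  nonneg n := mul_nonneg (inv_nonneg.2 h.alpha_pos.le)
    (mul_nonneg (Nat.cast_nonneg _) (pow_nonneg h.rho_pos.le _))
  summable := h.hasSum_normCoeff.summable
  tsum_le := by
    rw [h.hasSum_normCoeff.tsum_eq, inv_mul_le_iff₀ h.alpha_pos, mul_one]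
    exact h.tsum_coeff_genFun_le
  eq z hz := by
    obtain ⟨w, hw, rfl⟩ := exists_pow_eq_of_norm_le_one h.setGcd_pos hz
    exact h.ogf_weight_eq hw

end IsAdmissible

section DentedDomain

theorem one_sub_cos_mul_norm_sqrt_sq_le {φ : ℝ} (hφ : 0 ≤ φ) {w : ℂ}
    (hw : φ < |Complex.arg (w - 1)|) :
    (1 - Real.cos φ) * ‖Complex.sqrt (1 - w)‖ ^ 2 ≤ 2 * (Complex.sqrt (1 - w)).re ^ 2 := by
  have hre : -(1 - w).re ≤ ‖1 - w‖ * Real.cos φ := by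
    rw [← Complex.neg_re, neg_sub, norm_sub_rev, ← Complex.norm_mul_cos_arg, ← Real.cos_abs]
    exact mul_le_mul_of_nonneg_left (Real.cos_le_cos_of_nonneg_of_le_pi hφ
      (Complex.abs_arg_le_pi _) hw.le) (norm_nonneg _)
  have hnorm := Complex.sq_norm (Complex.sqrt (1 - w))
  rw [Complex.normSq_apply] at hnorm
  rw [← norm_sqrt_sq] at hre
  linarith [re_sq_sub_im_sq_sqrt (1 - w)]

theorem re_sq_le_norm_mul_add_sq {a : ℝ} {s σ : ℂ} (ha : 1 ≤ a) (hs : 0 ≤ s.re)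
    (hσ : 0 ≤ σ.re) : s.re ^ 2 ≤ ‖(a : ℂ) * s + σ‖ ^ 2 := by
  have hre := Complex.re_le_norm ((a : ℂ) * s + σ)
  rw [Complex.add_re, Complex.re_ofReal_mul] at hre
  exact pow_le_pow_left₀ hs (by linarith [le_mul_of_one_le_left hs ha]) 2

theorem isBigO_sqrt_one_sub_add {d : ℕ} (hd : 0 < d) {φ : ℝ} (hφ : 0 < φ) (hφπ : φ ≤ Real.pi) :
    (fun w : ℂ => Complex.sqrt (1 - w)) =O[𝓝[{w : ℂ | φ < |Complex.arg (w - 1)|}] 1]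
      fun w => (√d : ℂ) * Complex.sqrt (1 - w) + Complex.sqrt (1 - w ^ d) := by
  have hcos : 0 < 1 - Real.cos φ := by
    rw [sub_pos, ← Real.cos_zero]
    exact Real.cos_lt_cos_of_nonneg_of_le_pi le_rfl hφπ hφ
  refine IsBigO.of_pow two_ne_zero (IsBigO.of_bound (2 / (1 - Real.cos φ))
    (eventually_mem_nhdsWithin.mono fun w hw => ?_))
  have hsum := re_sq_le_norm_mul_add_sq (Real.one_le_sqrt.2 (Nat.one_le_cast.2 hd))
    (re_sqrt_nonneg (1 - w)) (re_sqrt_nonneg (1 - w ^ d))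
  rw [Pi.pow_apply, Pi.pow_apply, norm_pow, norm_pow, div_mul_eq_mul_div, le_div_iff₀' hcos]
  exact (one_sub_cos_mul_norm_sqrt_sq_le hφ.le hw).trans (mul_le_mul_of_nonneg_left hsum two_pos.le)

theorem isBigO_mul_one_sub_sub_one_sub_pow (d : ℕ) :
    (fun w : ℂ => (d : ℂ) * (1 - w) - (1 - w ^ d)) =O[𝓝 1] fun w => (1 - w) * (1 - w) := by
  have hgeom : (fun w : ℂ => d - ∑ i ∈ Finset.range d, w ^ i) =O[𝓝 1] fun w => 1 - w := by
    have hdiff : DifferentiableAt ℂ (fun w : ℂ => ∑ i ∈ Finset.range d, w ^ i) 1 := by fun_prop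
    simpa using hdiff.isBigO_sub.neg_left.neg_right
  refine ((isBigO_refl (fun w : ℂ => 1 - w) _).mul hgeom).congr_left fun w => ?_
  linear_combination -mul_neg_geom_sum w d

theorem isBigO_one_sub_sqrt_one_sub :
    (fun w : ℂ => 1 - w) =O[𝓝 1] fun w => Complex.sqrt (1 - w) := by
  refine ((isBigO_refl (fun w : ℂ => Complex.sqrt (1 - w)) (𝓝 1)).mul
    (tendsto_sqrt_one_sub.isBigO_one ℂ)).congr (fun w => ?_) fun w => mul_one _
  rw [← pow_two, sqrt_sq]

/-- The product of `√d √(1 - w) - √(1 - w ^ d)` with the corresponding sum is `O((1 - w) ^ 2)`, and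
away from the cut `√(1 - w)` is dominated by the sum. -/
theorem isBigO_sqrt_one_sub_pow {d : ℕ} (hd : 0 < d) {φ : ℝ} (hφ : 0 < φ) (hφπ : φ ≤ Real.pi) :
    (fun w : ℂ => (√d : ℂ) * Complex.sqrt (1 - w) - Complex.sqrt (1 - w ^ d))
      =O[𝓝[{w : ℂ | φ < |Complex.arg (w - 1)|}] 1] fun w => 1 - w := by
  have hprod : (fun w : ℂ => ((√d : ℂ) * Complex.sqrt (1 - w) - Complex.sqrt (1 - w ^ d)) *
      ((√d : ℂ) * Complex.sqrt (1 - w) + Complex.sqrt (1 - w ^ d)))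
      =O[𝓝 1] fun w => (1 - w) * (1 - w) := by
    refine (isBigO_mul_one_sub_sub_one_sub_pow d).congr_left fun w => ?_
    have hsqrt : (√d : ℂ) ^ 2 = d := by
      rw [← Complex.ofReal_pow, Real.sq_sqrt (Nat.cast_nonneg d), Complex.ofReal_natCast]
    linear_combination -(Complex.sqrt (1 - w) ^ 2) * hsqrt - (d : ℂ) * sqrt_sq (1 - w) +
      sqrt_sq (1 - w ^ d)
  have hmul := ((isBigO_refl _ _).mul (isBigO_sqrt_one_sub_add hd hφ hφπ)).trans
    ((hprod.trans ((isBigO_refl (fun w : ℂ => 1 - w) _).mul isBigO_one_sub_sqrt_one_sub)).mono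
      nhdsWithin_le_nhds)
  refine (hmul.mul (isBigO_refl (fun w : ℂ => (Complex.sqrt (1 - w))⁻¹) _)).congr' ?_ ?_ <;>
  · filter_upwards [self_mem_nhdsWithin] with w (hw : φ < |Complex.arg (w - 1)|)
    refine mul_inv_cancel_right₀ (sqrt_ne_zero (sub_ne_zero.2 ?_)) _
    rintro rfl
    rw [sub_self, Complex.arg_zero, abs_zero] at hw
    exact lt_asymm hφ hw

theorem mem_dentedDomain_of_mem_indentedDisc {d : ℕ} {ρ φ R : ℝ} {x : ℂ}
    (hx : x ∈ indentedDisc d ρ φ R) : x / ρ ∈ dentedDomain φ R := by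
  simpa only [mul_one] using hx 1 (one_pow d)

theorem eq_ofReal_norm_of_one_sub_notMem_slitPlane {z : ℂ} (hz : 1 - z ∉ Complex.slitPlane) :
    z = (‖z‖ : ℂ) ∧ 1 ≤ ‖z‖ := by
  rw [Complex.mem_slitPlane_iff, Complex.sub_re, Complex.one_re, sub_pos, Complex.sub_im,
    Complex.one_im, zero_sub, neg_ne_zero] at hz
  push Not at hz
  have hreal : z = (z.re : ℂ) := Complex.ext rfl hz.2
  rw [hreal, Complex.norm_real, Real.norm_of_nonneg (zero_le_one.trans hz.1)]
  exact ⟨rfl, hz.1⟩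

/-- If `(x / ρ) ^ d` lay on the cut `[1, ∞)`, then `x / ρ` divided by the `d`-th root of unity in
its direction would be a real number at least `1`, at which `dentedDomain` is dented. -/
theorem one_sub_pow_mem_slitPlane {d : ℕ} (hd : 0 < d) {ρ φ R : ℝ} (hφ : 0 < φ) {x : ℂ}
    (hx : x ∈ indentedDisc d ρ φ R) : 1 - (x / ρ) ^ d ∈ Complex.slitPlane := by
  by_contra hcut
  obtain ⟨hreal, hge⟩ := eq_ofReal_norm_of_one_sub_notMem_slitPlane hcut
  rw [norm_pow, Complex.ofReal_pow] at hreal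
  rw [norm_pow, one_le_pow_iff_of_nonneg (norm_nonneg _) hd.ne'] at hge
  set w := x / (ρ : ℂ) with hw
  have hnorm : (‖w‖ : ℂ) ≠ 0 := Complex.ofReal_ne_zero.2 (one_pos.trans_le hge).ne'
  have hroot : (w / ‖w‖) ^ d = 1 := by rw [div_pow, hreal, div_self (pow_ne_zero d hnorm)]
  have hdir : x / ((ρ : ℂ) * (w / ‖w‖)) = (‖w‖ : ℂ) := by
    rw [← div_div, ← hw, div_div_cancel₀ (norm_pos_iff.1 (one_pos.trans_le hge))]
  have harg := (hx _ hroot).2.2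
  rw [hdir, ← Complex.ofReal_one, ← Complex.ofReal_sub,
    Complex.arg_ofReal_of_nonneg (sub_nonneg.2 hge), abs_zero] at harg
  exact lt_asymm hφ harg

theorem isBigO_one_sub_pow (d : ℕ) : (fun w : ℂ => 1 - w ^ d) =O[𝓝 1] fun w => 1 - w := by
  have hdiff : DifferentiableAt ℂ (fun w : ℂ => w ^ d) 1 := by fun_prop
  simpa using hdiff.isBigO_sub.neg_left.neg_right

theorem isBigO_comp_pow_sub {d : ℕ} (hd : 0 < d) {F T : ℂ → ℂ} (hT : AnalyticAt ℂ T 0)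
    (hF : ∀ᶠ z in 𝓝 1, 1 - z ∈ Complex.slitPlane → F z = T (Complex.sqrt (1 - z)))
    {φ : ℝ} (hφ : 0 < φ) (hφπ : φ ≤ Real.pi) {A : Set ℂ}
    (hA : ∀ w ∈ A, 1 - w ^ d ∈ Complex.slitPlane)
    (harg : ∀ w ∈ A, φ < |Complex.arg (w - 1)|) :
    (fun w => F (w ^ d) - (T 0 + deriv T 0 * (√d : ℂ) * Complex.sqrt (1 - w)))
      =O[𝓝[A] 1] fun w => 1 - w := by
  obtain ⟨g, hg, hTaylor⟩ := hT.exists_eq_sum_add_pow_mul 2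
  simp only [Finset.sum_range_succ, Finset.sum_range_zero, iteratedDeriv_zero, iteratedDeriv_one,
    zero_add, smul_eq_mul, pow_zero, pow_one, Nat.factorial_zero, Nat.factorial_one, Nat.cast_one,
    div_one, one_mul] at hTaylor
  have hpow : Tendsto (fun w : ℂ => w ^ d) (𝓝 1) (𝓝 1) := by
    simpa only [one_pow] using (continuous_pow d).tendsto (1 : ℂ)
  have hrem : (fun w : ℂ => (1 - w ^ d) * g (Complex.sqrt (1 - w ^ d)))
      =O[𝓝[A] 1] fun w => 1 - w := by
    have hbdd : (fun w : ℂ => g (Complex.sqrt (1 - w ^ d))) =O[𝓝 1] fun _ => (1 : ℂ) :=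
      (hg.continuousAt.tendsto.comp (tendsto_sqrt_one_sub.comp hpow)).isBigO_one ℂ
    simpa only [mul_one] using ((isBigO_one_sub_pow d).mul hbdd).mono nhdsWithin_le_nhds
  have hlin := ((isBigO_sqrt_one_sub_pow hd hφ hφπ).mono (nhdsWithin_mono 1 harg)).const_mul_left
    (deriv T 0)
  refine (hrem.sub hlin).congr' ?_ EventuallyEq.rfl
  filter_upwards [self_mem_nhdsWithin, mem_nhdsWithin_of_mem_nhds (hpow.eventually hF)]
    with w hw hFw
  rw [hFw (hA w hw), hTaylor, sqrt_sq]
  ring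

theorem isBigO_comp_div_pow_sub {d : ℕ} (hd : 0 < d) {F T : ℂ → ℂ} (hT : AnalyticAt ℂ T 0)
    (hF : ∀ᶠ z in 𝓝 1, 1 - z ∈ Complex.slitPlane → F z = T (Complex.sqrt (1 - z)))
    {ρ φ : ℝ} (hρ : ρ ≠ 0) (hφ : 0 < φ) (hφπ : φ ≤ Real.pi) (R : ℝ) :
    (fun x : ℂ => F ((x / ρ) ^ d) - (T 0 + deriv T 0 * (√d : ℂ) * Complex.sqrt (1 - x / ρ)))
      =O[𝓝[indentedDisc d ρ φ R] (ρ : ℂ)] fun x => 1 - x / ρ := by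
  have hlim : Tendsto (fun x : ℂ => x / ρ) (𝓝[indentedDisc d ρ φ R] (ρ : ℂ))
      (𝓝[(fun x : ℂ => x / ρ) '' indentedDisc d ρ φ R] 1) := by
    have hcont : ContinuousAt (fun x : ℂ => x / ρ) (ρ : ℂ) := by fun_prop
    simpa only [div_self (Complex.ofReal_ne_zero.2 hρ)] using
      hcont.continuousWithinAt.tendsto_nhdsWithin_image (s := indentedDisc d ρ φ R)
  exact (isBigO_comp_pow_sub hd hT hF hφ hφπ
    (Set.forall_mem_image.2 fun _ hx => one_sub_pow_mem_slitPlane hd hφ hx)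
    (Set.forall_mem_image.2 fun _ hx =>
      (mem_dentedDomain_of_mem_indentedDisc hx).2.2)).comp_tendsto hlim

theorem analyticOnNhd_comp_div_pow {d : ℕ} (hd : 0 < d) {F : ℂ → ℂ} {ρ φ R : ℝ} (hφ : 0 < φ)
    (hF : ∀ z, 1 - z ∈ Complex.slitPlane → ‖z‖ < R ^ d → AnalyticAt ℂ F z) :
    AnalyticOnNhd ℂ (fun x : ℂ => F ((x / ρ) ^ d)) (indentedDisc d ρ φ R) := fun x hx =>
  AnalyticAt.comp (f := fun x : ℂ => (x / ρ) ^ d) (hF _ (one_sub_pow_mem_slitPlane hd hφ hx) (by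
    rw [norm_pow]
    exact pow_lt_pow_left₀ (mem_dentedDomain_of_mem_indentedDisc hx).2.1 (norm_nonneg _) hd.ne'))
    (by fun_prop)

end DentedDomain

theorem mul_rpow_neg_three_halves {x y : ℝ} (hx : 0 < x) (hy : 0 ≤ y) :
    (x * y) ^ (-(3 / 2) : ℝ) = (x * √x)⁻¹ * y ^ (-(3 / 2) : ℝ) := by
  rw [Real.mul_rpow hx.le hy, Real.rpow_neg hx.le, show (3 / 2 : ℝ) = 1 + 1 / 2 by norm_num,
    Real.rpow_add hx, Real.rpow_one, ← Real.sqrt_eq_rpow]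

namespace IsAdmissible

variable {S : Set ℕ}

theorem alpha_mul_sqrt_mul_sqrt (h : IsAdmissible S) :
    alpha S * √(2 / (Nat.setGcd S * weightVariance S)) * √(Nat.setGcd S) = beta S := by
  have hα := h.alpha_pos
  have hd : (0 : ℝ) < Nat.setGcd S := Nat.cast_pos.2 h.setGcd_pos
  have hV := h.weightVariance_pos
  rw [h.beta_eq, mul_assoc, ← Real.sqrt_mul (by positivity)]
  nth_rewrite 1 [← Real.sqrt_sq hα.le]
  rw [← Real.sqrt_mul (sq_nonneg _)]
  congr 1
  rw [weightVariance] at hV ⊢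
  have hsum := (mul_pos_iff_of_pos_left (inv_pos.2 hα)).1 hV
  field_simp

theorem hasSum_coeff_genFun (h : IsAdmissible S) {F : ℂ → ℂ}
    (hF : ∀ z, ‖z‖ < 1 → F z = ogf (normCoeff S) z) {x : ℂ} (hx : ‖x‖ < rho S) :
    HasSum (fun n => ((PowerSeries.coeff n (genFun S) : ℕ) : ℂ) * x ^ n)
      (alpha S * F ((x / rho S) ^ Nat.setGcd S)) := by
  have hw : ‖x / rho S‖ < 1 := by
    rwa [norm_div, Complex.norm_real, Real.norm_of_nonneg h.rho_pos.le, div_lt_one h.rho_pos]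
  rw [hF _ (by rw [norm_pow]; exact pow_lt_one₀ (norm_nonneg _) hw h.setGcd_pos.ne'),
    ← h.tsum_coeff_genFun_rho_mul hw.le, mul_div_cancel₀ x (Complex.ofReal_ne_zero.2 h.rho_pos.ne')]
  exact (h.hasAbsEval_genFun hx.le).hasSum

theorem exists_expansion (h : IsAdmissible S) :
    ∃ φ R : ℝ, 0 < φ ∧ φ < Real.pi / 2 ∧ 1 < R ∧ ∃ F : ℂ → ℂ,
      AnalyticOnNhd ℂ F (indentedDisc (Nat.setGcd S) (rho S) φ R) ∧
      (∀ x : ℂ, ‖x‖ < rho S →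
        HasSum (fun n : ℕ => ((PowerSeries.coeff n (genFun S) : ℕ) : ℂ) * x ^ n) (F x)) ∧
      (fun x : ℂ => F x - ((alpha S : ℂ) - (beta S : ℂ) * Complex.sqrt (1 - x / (rho S : ℂ))))
        =O[𝓝[indentedDisc (Nat.setGcd S) (rho S) φ R] (rho S : ℂ)]
          (fun x : ℂ => 1 - x / (rho S : ℂ)) := by
  obtain ⟨r, hr⟩ := h.exists_isCritical
  obtain ⟨R, hR, F, T, hF, hFc, hT, hT0, hT', hFT⟩ := h.isSolution.exists_continuation hr
  have hd := h.setGcd_pos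
  have hπ := Real.pi_pos
  have hroot : (R ^ ((Nat.setGcd S : ℝ)⁻¹)) ^ Nat.setGcd S = R :=
    Real.rpow_inv_natCast_pow (by linarith) hd.ne'
  refine ⟨Real.pi / 3, R ^ ((Nat.setGcd S : ℝ)⁻¹), by positivity, by linarith,
    Real.one_lt_rpow hR (by positivity), fun x => alpha S * F ((x / rho S) ^ Nat.setGcd S),
    analyticOnNhd_const.mul (analyticOnNhd_comp_div_pow hd (by positivity) (by rwa [hroot])),
    fun x => h.hasSum_coeff_genFun hFc, ?_⟩
  refine ((isBigO_comp_div_pow_sub hd hT hFT h.rho_pos.ne' (by positivity) (by linarith)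
    _).const_mul_left (alpha S : ℂ)).congr_left fun x => ?_
  rw [hT0, hT', ← h.alpha_mul_sqrt_mul_sqrt]
  push_cast
  ring

theorem tendsto_normCoeff (h : IsAdmissible S) :
    Tendsto (fun m => normCoeff S m * (m : ℝ) ^ (3 / 2 : ℝ)) atTop
      (𝓝 (beta S / (alpha S * √(Nat.setGcd S)) * (1 / (2 * √Real.pi)))) := by
  obtain ⟨r, hr⟩ := h.exists_isCritical
  obtain ⟨R, hR, F, T, hF, hFc, hT, -, hT', hFT⟩ := h.isSolution.exists_continuation hr
  have hlim := tendsto_coeff_of_sqrt_singularity (c := fun m => (normCoeff S m : ℂ))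
    (fun z hz hz1 => hF z (one_sub_mem_slitPlane hz hz1) (hz.trans_lt hR))
    (fun z hz => hFc z hz ▸ h.isSolution.hasSum hz.le) hT
    (hFT.mono fun z hz hz1 => hz (one_sub_mem_slitPlane hz1.le (ne_of_apply_ne norm (by
      rw [norm_one]
      exact hz1.ne))))
  rw [hT'] at hlim
  have hα := h.alpha_pos.ne'
  have hd : √(Nat.setGcd S : ℝ) ≠ 0 := (Real.sqrt_pos.2 (Nat.cast_pos.2 h.setGcd_pos)).ne'
  rw [← h.alpha_mul_sqrt_mul_sqrt]
  convert (Complex.continuous_re.tendsto _).comp hlim using 2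
  · rw [Function.comp_apply, ← Complex.ofReal_mul, Complex.ofReal_re]
  · rw [← Complex.ofReal_neg, ← Complex.ofReal_mul, Complex.ofReal_re]
    field_simp

theorem coeff_genFun_mul_eq (h : IsAdmissible S) (m : ℕ) :
    ((PowerSeries.coeff (Nat.setGcd S * m) (genFun S) : ℕ) : ℝ) =
      alpha S * normCoeff S m * rho S ^ (-((Nat.setGcd S * m : ℕ) : ℤ)) := by
  rw [normCoeff, mul_inv_cancel_left₀ h.alpha_pos.ne', zpow_neg, zpow_natCast,
    mul_inv_cancel_right₀ (pow_pos h.rho_pos _).ne']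

theorem isEquivalent_coeff_genFun (h : IsAdmissible S) :
    (fun n : ℕ => ((PowerSeries.coeff n (genFun S) : ℕ) : ℝ))
      ~[atTop ⊓ 𝓟 {n : ℕ | Nat.setGcd S ∣ n}]
      (fun n : ℕ => (Nat.setGcd S : ℝ) * beta S / (2 * √Real.pi) *
        (n : ℝ) ^ (-(3 / 2) : ℝ) * rho S ^ (-(n : ℤ))) := by
  have hd := h.setGcd_pos
  have hα := h.alpha_pos
  have hβ := h.beta_pos
  have hpos : ∀ᶠ n : ℕ in atTop ⊓ 𝓟 {n : ℕ | Nat.setGcd S ∣ n}, 0 < n ∧ Nat.setGcd S ∣ n :=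
    eventually_inf_principal.2 ((eventually_gt_atTop 0).mono fun n hn hdn => ⟨hn, hdn⟩)
  have hequiv := (((isEquivalent_const_iff_tendsto (by positivity)).2
    h.tendsto_normCoeff).comp_tendsto ((Nat.tendsto_div_const_atTop hd.ne').mono_left
      (inf_le_left (b := 𝓟 {n : ℕ | Nat.setGcd S ∣ n})))).mul
    (IsEquivalent.refl (u := fun n : ℕ => alpha S * ((n / Nat.setGcd S : ℕ) : ℝ) ^ (-(3 / 2) : ℝ) *
      rho S ^ (-(n : ℤ))))
  refine (hequiv.congr_left ?_).congr_right ?_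
  · filter_upwards [hpos] with n ⟨hn, m, hm⟩
    subst hm
    have hmpos : (0 : ℝ) < m := Nat.cast_pos.2 (Nat.pos_of_mul_pos_left hn)
    rw [Pi.mul_apply, Function.comp_apply, Nat.mul_div_cancel_left m hd, h.coeff_genFun_mul_eq,
      Real.rpow_neg hmpos.le]
    field_simp
  · filter_upwards [hpos] with n ⟨hn, m, hm⟩
    subst hm
    rw [Pi.mul_apply, Function.comp_apply, Function.const_apply, Nat.mul_div_cancel_left m hd,
      Nat.cast_mul (α := ℝ), mul_rpow_neg_three_halves (Nat.cast_pos.2 hd) m.cast_nonneg]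
    field_simp

end IsAdmissible

end CrossingFree

theorem mainTheorem7 (S : Set ℕ) (hne : S.Nonempty) (hpos : 0 ∉ S) (hS : S ≠ {1}) :
    -- the constants are well defined
    ((∃! t : ℝ, CrossingFree.IsTau S t) ∧
      Summable (fun s : S => CrossingFree.tau S ^ (s : ℕ)) ∧
      Summable (fun s : S => ((s : ℕ) : ℝ) * CrossingFree.tau S ^ (s : ℕ)) ∧
      Summable (fun s : S =>
        ((s : ℕ) : ℝ) * (((s : ℕ) : ℝ) - 1) * CrossingFree.tau S ^ (s : ℕ)) ∧
      0 < CrossingFree.rho S ∧ 0 < CrossingFree.beta S) ∧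
    -- singular expansion at `ρ_S` of the analytic continuation to a dented domain
    (∃ φ R : ℝ, 0 < φ ∧ φ < Real.pi / 2 ∧ 1 < R ∧ ∃ F : ℂ → ℂ,
      AnalyticOnNhd ℂ F
        (CrossingFree.indentedDisc (Nat.setGcd S) (CrossingFree.rho S) φ R) ∧
      (∀ x : ℂ, ‖x‖ < CrossingFree.rho S →
        HasSum (fun n : ℕ => ((PowerSeries.coeff n (CrossingFree.genFun S) : ℕ) : ℂ) * x ^ n)
          (F x)) ∧
      (fun x : ℂ => F x - ((CrossingFree.alpha S : ℂ) -
          (CrossingFree.beta S : ℂ) * Complex.sqrt (1 - x / (CrossingFree.rho S : ℂ))))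
        =O[𝓝[CrossingFree.indentedDisc (Nat.setGcd S) (CrossingFree.rho S) φ R]
            (CrossingFree.rho S : ℂ)]
          (fun x : ℂ => 1 - x / (CrossingFree.rho S : ℂ))) ∧
    -- asymptotics of the coefficients along the multiples of `gcd(S)`
    ((fun n : ℕ => ((PowerSeries.coeff n (CrossingFree.genFun S) : ℕ) : ℝ))
      ~[atTop ⊓ 𝓟 {n : ℕ | Nat.setGcd S ∣ n}]
      (fun n : ℕ => (Nat.setGcd S : ℝ) * CrossingFree.beta S / (2 * Real.sqrt Real.pi) *
        (n : ℝ) ^ (-(3 / 2) : ℝ) * CrossingFree.rho S ^ (-(n : ℤ)))) ∧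
    -- the other coefficients vanish
    (∀ n : ℕ, ¬ Nat.setGcd S ∣ n → PowerSeries.coeff n (CrossingFree.genFun S) = 0) := by
  have h : CrossingFree.IsAdmissible S := ⟨hne, hpos, hS⟩
  exact ⟨⟨h.existsUnique_isTau, h.summable_tau_pow, h.summable_mul_tau_pow,
    h.summable_mul_sub_one_mul_tau_pow, h.rho_pos, h.beta_pos⟩, h.exists_expansion,
    h.isEquivalent_coeff_genFun,
    fun _ hn => CrossingFree.coeff_genFun_eq_zero_of_not_setGcd_dvd hn⟩
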